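/- Let $k$ be a field, let $G$ be a finite simple graph with vertices $x_1,\dots,x_n$, let $S=k[x_1,\dots,x_n]$, and let $I=I(G)=(x_ix_j \mid \{x_i,x_j\}\in E(G))\subseteq S$ be the edge ideal of $G$. For a monomial ideal $J\subseteq S$, label every nonempty set $\sigma$ of minimal monomial generators of $J$ with the monomial $m_\sigma=\operatorname{lcm}(\sigma)$. The Scarf complex $\mathrm{Scarf}(J)$ is the simplicial complex of those $\sigma$ whose label is not the label of any other nonempty set of minimal generators. A simplicial complex $\Delta$ on minimal generators of $J$ supports a free resolution of $J$ if its homogenized chain complex is a free resolution of $J$; here the module in degree $i$ is free on the $i$-dimensional faces of $\Delta$, the differential sends the basis element $e_\sigma$ to $\sum_{v\in\sigma}\pm\frac{m_\sigma}{m_{\sigma\setminus\{v\}}}\,e_{\sigma\setminus\{v\}}$ with the usual simplicial signs, and the augmentation to $S$ sends $e_{\{v\}}$ to $v$. The ideal $J$ has a Scarf resolution if $\mathrm{Scarf}(J)$ supports a free resolution of $J$. Call $G$ gap-free if, whenever $x_1x_2$ and $y_1y_2$ are edges in the same connected component of $G$, $x_iy_j$ is an edge of $G$ for some $i,j\in\{1,2\}$.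 (1) $I$ has a minimal free resolution supported on its Scarf complex if and only if $G$ is a gap-free forest; equivalently, $I$ has a Scarf resolution if and only if $G$ is a gap-free forest. (2) If $G$ is connected and $t>1$ is an integer, then $I^t$ has a minimal free resolution supported on its Scarf complex (equivalently, $I^t$ has a Scarf resolution) if and only if $G$ is an isolated vertex, an edge, or a path of length $2$ (that is, a path with three vertices). -/

import Mathlib

noncomputable section

namespace ScarfIdeal

variable {V : Type*}

/-! ### Monomial ideals, the Taylor simplex and the Scarf complex

A monomial of `k[x_v : v ∈ V]` is represented by its exponent vector `V →₀ ℕ`.  Divisibility is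
then the pointwise order `≤`, and the least common multiple is the supremum. -/

/-- The (exponents of the) minimal monomial generators of a monomial ideal `I`: the monomials in
`I` that are minimal for divisibility. -/
def gens {k : Type*} [Field k] (I : Ideal (MvPolynomial V k)) : Set (V →₀ ℕ) :=
  {a | Minimal (fun b : V →₀ ℕ => MvPolynomial.monomial b (1 : k) ∈ I) a}

/-- The label of a face: the least common multiple of the labels of its vertices. -/
def label (σ : Finset (V →₀ ℕ)) : V →₀ ℕ := σ.sup id

/-- The Taylor complex: the full simplex on the set `M` of monomials. Its faces are all nonempty
finite subsets. -/
def taylorComplex (M : Set (V →₀ ℕ)) : PreAbstractSimplicialComplex (V →₀ ℕ) where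
  faces := {σ | σ.Nonempty ∧ (σ : Set (V →₀ ℕ)) ⊆ M}
  isRelLowerSet_faces := fun _ h =>
    ⟨h.1, fun _ hτ hne => ⟨hne, (Finset.coe_subset.mpr hτ).trans h.2⟩⟩

/-- The Scarf complex of `I`: the faces of the Taylor complex of `I` whose label is not the label
of any other face of the Taylor complex. -/
def scarfComplex {k : Type*} [Field k] (I : Ideal (MvPolynomial V k)) :
    PreAbstractSimplicialComplex (V →₀ ℕ) where
  faces := {σ | σ ∈ taylorComplex (gens I) ∧
    ∀ τ ∈ taylorComplex (gens I), label τ = label σ → τ = σ}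
  isRelLowerSet_faces := by
    classical
    rintro σ ⟨hσ, huniq⟩
    refine ⟨hσ.1, fun τ hτσ hτ => ?_⟩
    have hsub : (τ : Set (V →₀ ℕ)) ⊆ gens I := (Finset.coe_subset.mpr hτσ).trans hσ.2
    refine ⟨⟨hτ, hsub⟩, fun ρ hρ hlab => ?_⟩
    have h1 : label (ρ ∪ (σ \ τ)) = label σ := by
      have h2 : label (τ ∪ (σ \ τ)) = label σ := by
        rw [Finset.union_sdiff_of_subset hτσ]
      rw [← h2]
      simp only [label, Finset.sup_union] at hlab ⊢
      rw [hlab]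
    have h3 : ρ ∪ (σ \ τ) = σ := by
      refine huniq _ ⟨hρ.1.mono Finset.subset_union_left, ?_⟩ h1
      intro x hx
      rcases Finset.mem_union.mp (Finset.mem_coe.mp hx) with hx | hx
      · exact hρ.2 hx
      · exact hσ.2 (Finset.mem_sdiff.mp hx).1
    have hρσ : ρ ⊆ σ := h3 ▸ Finset.subset_union_left
    have hτρ : τ ⊆ ρ := by
      intro x hx
      have hx' : x ∈ ρ ∪ (σ \ τ) := by rw [h3]; exact hτσ hx
      rcases Finset.mem_union.mp hx' with hx' | hx'
      · exact hx'
      · exact absurd hx (Finset.mem_sdiff.mp hx').2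
    refine Finset.Subset.antisymm (fun v hv => ?_) hτρ
    by_contra hvτ
    have hτe : τ ⊆ σ.erase v := fun x hx =>
      Finset.mem_erase.mpr ⟨fun h => hvτ (h ▸ hx), hτσ hx⟩
    have hle : v ≤ label (σ.erase v) := by
      calc v ≤ label ρ := Finset.le_sup (f := id) hv
        _ = label τ := hlab
        _ ≤ label (σ.erase v) := Finset.sup_mono hτe
    have hl : label (σ.erase v) = label σ := by
      refine le_antisymm (Finset.sup_mono (Finset.erase_subset _ _)) ?_
      refine Finset.sup_le fun x hx => ?_
      by_cases hxv : x = v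
      · exact hxv ▸ hle
      · exact Finset.le_sup (f := id) (Finset.mem_erase.mpr ⟨hxv, hx⟩)
    have he : σ.erase v = σ := huniq _ ⟨hτ.mono hτe,
      (Finset.coe_subset.mpr (Finset.erase_subset _ _)).trans hσ.2⟩ hl
    exact (Finset.erase_eq_self.mp he) (hρσ hv)

/-! ### The homogenized chain complex of a simplicial complex labelled by monomials -/

/-- The faces of dimension `i`, i.e. those with `i + 1` vertices. -/
def Faces (Δ : PreAbstractSimplicialComplex (V →₀ ℕ)) (i : ℕ) : Type _ :=
  {σ : Finset (V →₀ ℕ) // σ ∈ Δ ∧ σ.card = i + 1}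

/-- The free module on the faces of dimension `i`. -/
abbrev ChainModule (k : Type*) [Field k] (Δ : PreAbstractSimplicialComplex (V →₀ ℕ)) (i : ℕ) :
    Type _ :=
  Faces Δ i →₀ MvPolynomial V k

open Classical in
/-- The facet of `σ` opposite to its vertex `v`. -/
def Faces.facet {Δ : PreAbstractSimplicialComplex (V →₀ ℕ)} {i : ℕ} (σ : Faces Δ (i + 1))
    (v : {v // v ∈ σ.1}) : Faces Δ i :=
  ⟨σ.1.erase v.1, by
    have hc : (σ.1.erase v.1).card = i + 1 := by
      rw [Finset.card_erase_of_mem v.2, σ.2.2]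
      rfl
    exact ⟨(Δ.isRelLowerSet_faces σ.2.1).2 (Finset.erase_subset _ _)
      (Finset.card_pos.mp (by omega)), hc⟩⟩

open Classical in
/-- The incidence sign of the vertex `v` in `σ`: `(-1) ^ j`, where `j` is the number of vertices of
`σ` before `v`, for a fixed total order on all possible vertices. -/
def sign (σ : Finset (V →₀ ℕ)) (v : V →₀ ℕ) : ℤ :=
  (-1) ^ (σ.filter fun w => WellOrderingRel w v).card

/-- The homogenized simplicial boundary map `F_{i+1} → F_i`, sending the basis element of `σ` to
`∑ v ∈ σ, ± (m_σ / m_{σ \ v}) • (σ \ v)`. -/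
def boundary (k : Type*) [Field k] (Δ : PreAbstractSimplicialComplex (V →₀ ℕ)) (i : ℕ) :
    ChainModule k Δ (i + 1) →ₗ[MvPolynomial V k] ChainModule k Δ i :=
  Finsupp.linearCombination (MvPolynomial V k) fun σ : Faces Δ (i + 1) =>
    ∑ v : {v // v ∈ σ.1}, Finsupp.single (σ.facet v)
      (MvPolynomial.monomial (label σ.1 - label (σ.facet v).1) ((sign σ.1 v.1 : ℤ) : k))

/-- The map `F_0 → S` sending the basis element of a vertex to the monomial that labels it. -/
def augmentation (k : Type*) [Field k] (Δ : PreAbstractSimplicialComplex (V →₀ ℕ)) :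
    ChainModule k Δ 0 →ₗ[MvPolynomial V k] MvPolynomial V k :=
  Finsupp.linearCombination (MvPolynomial V k) fun σ : Faces Δ 0 =>
    MvPolynomial.monomial (label σ.1) (1 : k)

/-- `Δ` supports a free resolution of `I`: the sequence `⋯ → F_2 → F_1 → F_0 → S` is exact, and
the image of the last map is `I`. -/
def SupportsFreeResolution {k : Type*} [Field k] (Δ : PreAbstractSimplicialComplex (V →₀ ℕ))
    (I : Ideal (MvPolynomial V k)) : Prop :=
  LinearMap.range (augmentation k Δ) = I ∧
  Function.Exact (boundary k Δ 0) (augmentation k Δ) ∧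
  ∀ i : ℕ, Function.Exact (boundary k Δ (i + 1)) (boundary k Δ i)

/-- `Δ` supports a minimal free resolution of `I`: it supports a free resolution whose
differentials `F_{i+1} → F_i` have image in `𝔪 F_i`, where `𝔪` is generated by the variables. -/
def SupportsMinimalFreeResolution {k : Type*} [Field k]
    (Δ : PreAbstractSimplicialComplex (V →₀ ℕ)) (I : Ideal (MvPolynomial V k)) : Prop :=
  SupportsFreeResolution Δ I ∧
  ∀ (i : ℕ) (x : ChainModule k Δ (i + 1)) (τ : Faces Δ i),
    boundary k Δ i x τ ∈ Ideal.span (Set.range (MvPolynomial.X : V → MvPolynomial V k))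

/-- `I` is a Scarf ideal (`I` has a Scarf resolution): its Scarf complex supports a free
resolution of `I`. -/
def IsScarf {k : Type*} [Field k] (I : Ideal (MvPolynomial V k)) : Prop :=
  SupportsFreeResolution (scarfComplex I) I

/-! ### Graphs -/

/-- The edge ideal of a graph. -/
def edgeIdeal (k : Type*) [Field k] (G : SimpleGraph V) : Ideal (MvPolynomial V k) :=
  Ideal.span {p | ∃ u v : V, G.Adj u v ∧ p = MvPolynomial.X u * MvPolynomial.X v}

/-- A graph is gap-free if any two edges in the same connected component are joined by an edge
between an end of the one and an end of the other. -/
def GapFree (G : SimpleGraph V) : Prop :=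
  ∀ x₁ x₂ y₁ y₂ : V, G.Adj x₁ x₂ → G.Adj y₁ y₂ → G.Reachable x₁ y₁ →
    G.Adj x₁ y₁ ∨ G.Adj x₁ y₂ ∨ G.Adj x₂ y₁ ∨ G.Adj x₂ y₂

end ScarfIdeal

end

noncomputable section
namespace ScarfIdeal
variable {V : Type*}
open scoped Classical

/-! ### The augmented chain complex of a simplicial complex -/

/-! The homogenized chain complex of `Δ` is graded by monomials, and its part of degree `m` is the
augmented simplicial chain complex over `k` of `Δ_{≤ m}`, the faces whose label divides `m`. Hence
`Δ` supports a free resolution of `I` exactly when its vertices generate `I` and every `Δ_{≤ m}` is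
empty or acyclic (`supportsFreeResolution_iff`). For the Scarf complex the vertices are always the
minimal generators, and minimality is automatic because removing a vertex from a face strictly
lowers its label. Everything thus becomes a question about acyclicity of the complexes `Δ_{≤ m}`.

Two obstructions suffice for the negative results: an isolated vertex in the presence of another
vertex (`not_isScarf_of_isolated`), and an edge that lies on a cycle of edges but in no triangle
(`not_isScarf_of_hole`). The first excludes triangles of `G` for every positive power, and claws for
powers at least two; the second excludes paths on four vertices for powers at least two, and for the
first power it excludes 4-cycles, 5-cycles and induced paths on five vertices. A triangle-free graph
without induced five-vertex paths is gap-free, and a gap-free graph without cycles of length at most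
five is a forest. A connected graph without triangles, claws and four-vertex paths is a path on at
most three vertices.

Conversely, in a gap-free forest the edges dividing `m` within one component are all met by a single
one of them, `xy` (`exists_edge_meeting_all`). It can be adjoined to every face of `Δ_{≤ m}`
(`insert_mem_scarfComplex`), which is therefore a cone. For powers, an isolated vertex or an edge
gives at most one generator. For the path `a b c` the generators of the power `t` are `a^i b^t
c^(t-i)`; the Scarf complex is a path, and each `Δ_{≤ m}` is a subpath or empty
(`isScarf_of_gens_eq_image`). -/

theorem sign_mul_self (σ : Finset (V →₀ ℕ)) (v : V →₀ ℕ) : sign σ v * sign σ v = 1 := by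
  unfold sign
  rw [← pow_add, ← two_mul, pow_mul]
  simp

theorem sign_erase_of_rel {τ : Finset (V →₀ ℕ)} {u w : V →₀ ℕ} (hu : u ∈ τ)
    (h : WellOrderingRel u w) :
    sign (τ.erase u) w = - sign τ w ∧ sign (τ.erase w) u = sign τ u := by
  constructor
  · have h1 : ((τ.erase u).filter fun x => WellOrderingRel x w)
        = (τ.filter fun x => WellOrderingRel x w).erase u := by
      ext x; simp only [Finset.mem_filter, Finset.mem_erase]; tauto
    have h2 : u ∈ τ.filter fun x => WellOrderingRel x w := by simp [hu, h]
    have h3 := Finset.card_erase_add_one h2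
    unfold sign
    rw [h1, ← h3, pow_succ]
    simp
  · have h1 : ((τ.erase w).filter fun x => WellOrderingRel x u)
        = (τ.filter fun x => WellOrderingRel x u) := by
      ext x
      simp only [Finset.mem_filter, Finset.mem_erase]
      refine ⟨fun h => ⟨h.1.2, h.2⟩, fun hx => ⟨⟨?_, hx.1⟩, hx.2⟩⟩
      rintro rfl
      exact (asymm h hx.2).elim
    unfold sign
    rw [h1]

/-- Deleting the earlier of two vertices shifts the position of the later one by one, while deleting
the later one leaves the earlier in place. This is the cancellation behind both `∂ ∘ ∂ = 0` and the
cone homotopy. -/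
theorem sign_swap {τ : Finset (V →₀ ℕ)} {u w : V →₀ ℕ} (hu : u ∈ τ) (hw : w ∈ τ) (h : u ≠ w) :
    sign τ u * sign (τ.erase u) w = - (sign τ w * sign (τ.erase w) u) := by
  rcases trichotomous_of WellOrderingRel u w with h' | h' | h'
  · rw [(sign_erase_of_rel hu h').1, (sign_erase_of_rel hu h').2]; ring
  · exact absurd h' h
  · rw [(sign_erase_of_rel hw h').1, (sign_erase_of_rel hw h').2]; ring

/-- The boundary map of the augmented chain complex of the full simplex. -/
def simplexBoundary (V : Type*) (k : Type*) [Field k] :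
    (Finset (V →₀ ℕ) →₀ k) →ₗ[k] (Finset (V →₀ ℕ) →₀ k) :=
  Finsupp.linearCombination k fun σ =>
    ∑ v ∈ σ, Finsupp.single (σ.erase v) ((sign σ v : ℤ) : k)

variable {k : Type*} [Field k]

theorem simplexBoundary_single (σ : Finset (V →₀ ℕ)) (c : k) :
    simplexBoundary V k (Finsupp.single σ c) =
      ∑ v ∈ σ, Finsupp.single (σ.erase v) (c * ((sign σ v : ℤ) : k)) := by
  simp [simplexBoundary, Finset.smul_sum]

theorem simplexBoundary_simplexBoundary (z : Finset (V →₀ ℕ) →₀ k) :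
    simplexBoundary V k (simplexBoundary V k z) = 0 := by
  suffices h : simplexBoundary V k ∘ₗ simplexBoundary V k = 0 from LinearMap.congr_fun h z
  refine Finsupp.lhom_ext fun σ c => ?_
  simp only [LinearMap.comp_apply, simplexBoundary_single, map_sum, LinearMap.zero_apply]
  rw [Finset.sum_sigma']
  refine Finset.sum_involution (fun p _ => ⟨p.2, p.1⟩) ?_ ?_ ?_ ?_
  · rintro ⟨u, w⟩ h
    simp only [Finset.mem_sigma, Finset.mem_erase] at h
    rw [Finset.erase_right_comm, ← Finsupp.single_add, mul_assoc, mul_assoc, ← mul_add,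
      ← Int.cast_mul, ← Int.cast_mul, sign_swap h.1 h.2.2 (Ne.symm h.2.1)]
    simp
  · rintro ⟨u, w⟩ h _ h'
    simp only [Finset.mem_sigma, Finset.mem_erase] at h
    simp only [Sigma.mk.injEq] at h'
    exact h.2.1 h'.1
  · rintro ⟨u, w⟩ h
    simp only [Finset.mem_sigma, Finset.mem_erase] at h ⊢
    exact ⟨h.2.2, Ne.symm h.2.1, h.1⟩
  · rintro ⟨u, w⟩ h
    rfl

/-- Joining a chain with the vertex `w`. -/
def coneMap (k : Type*) [Field k] (w : V →₀ ℕ) :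
    (Finset (V →₀ ℕ) →₀ k) →ₗ[k] (Finset (V →₀ ℕ) →₀ k) :=
  Finsupp.linearCombination k fun σ =>
    if w ∈ σ then 0 else Finsupp.single (insert w σ) ((sign (insert w σ) w : ℤ) : k)

theorem coneMap_single (w : V →₀ ℕ) (σ : Finset (V →₀ ℕ)) (c : k) :
    coneMap k w (Finsupp.single σ c) = if w ∈ σ then 0 else
      Finsupp.single (insert w σ) (c * ((sign (insert w σ) w : ℤ) : k)) := by
  simp only [coneMap, Finsupp.linearCombination_single, smul_ite, smul_zero, Finsupp.smul_single,
    smul_eq_mul]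

/-- The cone homotopy. It holds on the whole simplex with the empty face included, so it can be
restricted to any complex that is closed under adjoining `w`. -/
theorem simplexBoundary_coneMap (w : V →₀ ℕ) (z : Finset (V →₀ ℕ) →₀ k) :
    simplexBoundary V k (coneMap k w z) + coneMap k w (simplexBoundary V k z) = z := by
  suffices h : simplexBoundary V k ∘ₗ coneMap k w + coneMap k w ∘ₗ simplexBoundary V k
      = LinearMap.id from LinearMap.congr_fun h z
  refine Finsupp.lhom_ext fun σ c => ?_
  simp only [LinearMap.add_apply, LinearMap.comp_apply, LinearMap.id_apply, coneMap_single,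
    simplexBoundary_single, map_sum]
  by_cases hw : w ∈ σ
  · rw [if_pos hw, map_zero, zero_add, Finset.sum_eq_single_of_mem w hw]
    · rw [if_neg (Finset.notMem_erase _ _), Finset.insert_erase hw, mul_assoc, ← Int.cast_mul,
        sign_mul_self]
      simp
    · intro u hu huw
      rw [if_pos (Finset.mem_erase.2 ⟨Ne.symm huw, hw⟩)]
  · rw [if_neg hw, simplexBoundary_single, Finset.sum_insert hw, Finset.erase_insert hw, mul_assoc,
      ← Int.cast_mul, sign_mul_self, add_assoc, ← Finset.sum_add_distrib, Finset.sum_eq_zero]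
    · simp
    · intro u hu
      have huw : w ≠ u := fun h => hw (h ▸ hu)
      rw [if_neg (fun h => hw (Finset.mem_of_mem_erase h)), mul_assoc, mul_assoc,
        Finset.erase_insert_of_ne huw, ← Finsupp.single_add, ← mul_add, ← Int.cast_mul,
        ← Int.cast_mul, ← Int.cast_add, ← Finset.erase_insert_of_ne huw]
      have h1 := sign_swap (Finset.mem_insert_of_mem hu) (Finset.mem_insert_self w σ) huw.symm
      rw [Finset.erase_insert hw] at h1
      have h2 := sign_mul_self (insert w σ) u
      have h3 := sign_mul_self σ u
      -- The swap relation multiplied by two signs; every sign squares to one.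
      have h4 : sign (insert w σ) w * sign (insert w σ) u
          + sign σ u * sign ((insert w σ).erase u) w = 0 := by
        linear_combination (sign (insert w σ) u * sign σ u) * h1
          - sign σ u * sign ((insert w σ).erase u) w * h2
          - sign (insert w σ) w * sign (insert w σ) u * h3
      rw [h4]
      simp

/-- The chains supported on the members of `K` with `n` elements. -/
def chains (k : Type*) [Field k] (K : Set (Finset (V →₀ ℕ))) (n : ℕ) :
    Submodule k (Finset (V →₀ ℕ) →₀ k) :=
  Finsupp.supported k k {σ | σ ∈ K ∧ σ.card = n}

theorem mem_chains {K : Set (Finset (V →₀ ℕ))} {n : ℕ} {z : Finset (V →₀ ℕ) →₀ k} :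
    z ∈ chains k K n ↔ ∀ σ, z σ ≠ 0 → σ ∈ K ∧ σ.card = n := by
  rw [chains, Finsupp.mem_supported]
  simp [Set.subset_def]

theorem single_mem_chains {K : Set (Finset (V →₀ ℕ))} {n : ℕ} {σ : Finset (V →₀ ℕ)}
    (h : σ ∈ K) (hn : σ.card = n) (c : k) : Finsupp.single σ c ∈ chains k K n :=
  Finsupp.single_mem_supported k c ⟨h, hn⟩

/-- A linear map sends chains to chains as soon as it does so on basis elements. -/
theorem map_mem_of_mem_chains {K : Set (Finset (V →₀ ℕ))} {n : ℕ} {z : Finset (V →₀ ℕ) →₀ k}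
    (hz : z ∈ chains k K n) (f : (Finset (V →₀ ℕ) →₀ k) →ₗ[k] (Finset (V →₀ ℕ) →₀ k))
    (N : Submodule k (Finset (V →₀ ℕ) →₀ k))
    (h : ∀ σ ∈ K, σ.card = n → ∀ c, f (Finsupp.single σ c) ∈ N) : f z ∈ N := by
  rw [← Finsupp.sum_single z, Finsupp.sum, map_sum]
  refine N.sum_mem fun σ hσ => ?_
  have := mem_chains.1 hz σ (by simpa using hσ)
  exact h σ this.1 this.2 _

theorem simplexBoundary_mem_chains {K : Set (Finset (V →₀ ℕ))} {n : ℕ}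
    (hK : ∀ σ ∈ K, ∀ v ∈ σ, σ.erase v ∈ K) {z : Finset (V →₀ ℕ) →₀ k}
    (hz : z ∈ chains k K (n + 1)) : simplexBoundary V k z ∈ chains k K n := by
  refine map_mem_of_mem_chains hz _ _ fun σ hσ hn c => ?_
  rw [simplexBoundary_single]
  refine Submodule.sum_mem _ fun v hv => single_mem_chains (hK σ hσ v hv) ?_ _
  rw [Finset.card_erase_of_mem hv, hn]; rfl

theorem coneMap_mem_chains {K L : Set (Finset (V →₀ ℕ))} {n : ℕ} (w : V →₀ ℕ)
    (h : ∀ σ ∈ K, insert w σ ∈ L) {z : Finset (V →₀ ℕ) →₀ k}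
    (hz : z ∈ chains k K n) : coneMap k w z ∈ chains k L (n + 1) := by
  refine map_mem_of_mem_chains hz _ _ fun σ hσ hn c => ?_
  rw [coneMap_single]
  split_ifs with hw
  · exact Submodule.zero_mem _
  · exact single_mem_chains (h σ hσ) (by rw [Finset.card_insert_of_notMem hw, hn]) _

/-- The reduced homology of `K` over `k` vanishes in nonnegative degrees. -/
def IsAcyclicComplex (k : Type*) [Field k] (K : Set (Finset (V →₀ ℕ))) : Prop :=
  ∀ n : ℕ, ∀ z ∈ chains k K (n + 1), simplexBoundary V k z = 0 →
    ∃ y ∈ chains k K (n + 2), simplexBoundary V k y = z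

theorem isAcyclicComplex_of_cone {K : Set (Finset (V →₀ ℕ))} (w : V →₀ ℕ)
    (h : ∀ σ ∈ K, insert w σ ∈ K) : IsAcyclicComplex k K := by
  intro n z hz hz0
  refine ⟨coneMap k w z, coneMap_mem_chains w h hz, ?_⟩
  have := simplexBoundary_coneMap w z
  rwa [hz0, map_zero, add_zero] at this

theorem chains_mono {K L : Set (Finset (V →₀ ℕ))} (h : K ⊆ L) (n : ℕ) :
    chains k K n ≤ chains k L n :=
  Finsupp.supported_mono fun _ hσ => ⟨h hσ.1, hσ.2⟩

/-- Deleting a vertex `v` dominated by another vertex `w` does not change the homology. -/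
theorem isAcyclicComplex_of_dominated {K : Set (Finset (V →₀ ℕ))}
    (hK : ∀ σ ∈ K, ∀ v ∈ σ, σ.erase v ∈ K) {v w : V →₀ ℕ} (hvw : v ≠ w)
    (h : ∀ σ ∈ K, v ∈ σ → insert w σ ∈ K) (hv : IsAcyclicComplex k {σ ∈ K | v ∉ σ}) :
    IsAcyclicComplex k K := by
  intro n z hz hz0
  set z₁ := z.filter (fun σ => v ∈ σ) with hz₁
  set z₂ := z.filter (fun σ => ¬ v ∈ σ) with hz₂
  have hsum : z₁ + z₂ = z := Finsupp.filter_add_filter_not z _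
  have hz₁K : z₁ ∈ chains k {σ ∈ K | v ∈ σ} (n + 1) := by
    refine mem_chains.2 fun σ hσ => ?_
    rw [hz₁, Finsupp.filter_apply] at hσ
    split_ifs at hσ with hvσ
    · exact ⟨⟨(mem_chains.1 hz σ hσ).1, hvσ⟩, (mem_chains.1 hz σ hσ).2⟩
    · exact absurd rfl hσ
  have hz₂K : z₂ ∈ chains k {σ ∈ K | v ∉ σ} (n + 1) := by
    refine mem_chains.2 fun σ hσ => ?_
    rw [hz₂, Finsupp.filter_apply] at hσ
    split_ifs at hσ with hvσ
    · exact absurd rfl hσ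
    · exact ⟨⟨(mem_chains.1 hz σ hσ).1, hvσ⟩, (mem_chains.1 hz σ hσ).2⟩
  have hW : coneMap k w z₁ ∈ chains k K (n + 2) :=
    coneMap_mem_chains w (fun σ hσ => h σ hσ.1 hσ.2) hz₁K
  -- A cycle homologous to `z`. The cone homotopy applied to `z₁` replaces the part through `v` by a
  -- chain built from `z₂` alone, so `v` no longer occurs.
  set z' := z - simplexBoundary V k (coneMap k w z₁) with hz'
  have hz'' : z' = z₂ - coneMap k w (simplexBoundary V k z₂) := by
    have h1 := simplexBoundary_coneMap w z₁
    have h2 : simplexBoundary V k z₁ = - simplexBoundary V k z₂ := by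
      rw [eq_neg_iff_add_eq_zero, ← map_add, hsum, hz0]
    rw [h2, map_neg] at h1
    rw [hz', ← hsum]
    nth_rewrite 1 [← h1]
    abel
  have hz'K : z' ∈ chains k {σ ∈ K | v ∉ σ} (n + 1) := by
    have h1 : z' ∈ chains k K (n + 1) := Submodule.sub_mem _ hz (simplexBoundary_mem_chains hK hW)
    have h2 : z' ∈ chains k {σ | v ∉ σ} (n + 1) := by
      rw [hz'']
      have h3 := chains_mono (k := k)
        (show {σ ∈ K | v ∉ σ} ⊆ {σ | v ∉ σ} from fun σ hσ => hσ.2) _ hz₂K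
      refine Submodule.sub_mem _ h3 (coneMap_mem_chains (K := {σ | v ∉ σ}) w ?_
        (simplexBoundary_mem_chains ?_ h3))
      · intro σ hσ h'
        rcases Finset.mem_insert.1 h' with h' | h'
        · exact hvw h'
        · exact hσ h'
      · intro σ hσ u hu h'
        exact hσ (Finset.mem_of_mem_erase h')
    refine mem_chains.2 fun σ hσ => ?_
    exact ⟨⟨(mem_chains.1 h1 σ hσ).1, (mem_chains.1 h2 σ hσ).1⟩, (mem_chains.1 h1 σ hσ).2⟩
  obtain ⟨y, hy, hyz⟩ := hv n z' hz'K (by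
    rw [hz', map_sub, hz0, simplexBoundary_simplexBoundary, sub_zero])
  refine ⟨y + coneMap k w z₁, Submodule.add_mem _ (chains_mono (fun σ hσ => hσ.1) _ hy) hW, ?_⟩
  rw [map_add, hyz, hz', sub_add_cancel]

end ScarfIdeal
end

noncomputable section
namespace ScarfIdeal
variable {V : Type*}
open scoped Classical
variable {k : Type*} [Field k]

/-! ### Multigraded components of the homogenized chain complex -/

/-- The faces of `Δ` whose label divides `m`, together with the empty face. -/
def facesBelow (Δ : PreAbstractSimplicialComplex (V →₀ ℕ)) (m : V →₀ ℕ) :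
    Set (Finset (V →₀ ℕ)) :=
  {σ | σ = ∅ ∨ σ ∈ Δ ∧ label σ ≤ m}

theorem erase_mem_facesBelow {Δ : PreAbstractSimplicialComplex (V →₀ ℕ)} {m : V →₀ ℕ} :
    ∀ σ ∈ facesBelow Δ m, ∀ v ∈ σ, σ.erase v ∈ facesBelow Δ m := by
  rintro σ (rfl | ⟨hσ, hm⟩) v hv
  · simp at hv
  · rcases Finset.eq_empty_or_nonempty (σ.erase v) with h | h
    · exact Or.inl h
    · exact Or.inr ⟨(Δ.isRelLowerSet_faces hσ).2 (Finset.erase_subset _ _) h,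
        (Finset.sup_mono (Finset.erase_subset _ _)).trans hm⟩

theorem label_facet_le {Δ : PreAbstractSimplicialComplex (V →₀ ℕ)} {i : ℕ} (σ : Faces Δ (i + 1))
    (v : {v // v ∈ σ.1}) : label (σ.facet v).1 ≤ label σ.1 :=
  Finset.sup_mono (Finset.erase_subset _ _)

/-- The component of degree `m` of a homogenized chain. -/
def component (k : Type*) [Field k] (Δ : PreAbstractSimplicialComplex (V →₀ ℕ)) (i : ℕ)
    (m : V →₀ ℕ) : ChainModule k Δ i →ₗ[k] (Finset (V →₀ ℕ) →₀ k) :=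
  Finsupp.lsum k fun σ : Faces Δ i =>
    if label σ.1 ≤ m then Finsupp.lsingle σ.1 ∘ₗ MvPolynomial.lcoeff k (m - label σ.1) else 0

variable {Δ : PreAbstractSimplicialComplex (V →₀ ℕ)} {i : ℕ} {m : V →₀ ℕ}

theorem component_single (σ : Faces Δ i) (p : MvPolynomial V k) :
    component k Δ i m (Finsupp.single σ p) =
      if label σ.1 ≤ m then Finsupp.single σ.1 (p.coeff (m - label σ.1)) else 0 := by
  rw [component, Finsupp.lsum_single]
  split_ifs <;> simp

theorem component_single_monomial (σ : Faces Δ i) (a : V →₀ ℕ) (c : k) :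
    component k Δ i m (Finsupp.single σ (MvPolynomial.monomial a c)) =
      if a + label σ.1 = m then Finsupp.single σ.1 c else 0 := by
  rw [component_single]
  by_cases h : a + label σ.1 = m
  · subst h
    simp
  · rw [if_neg h]
    split_ifs with h'
    · rw [MvPolynomial.coeff_monomial, if_neg, Finsupp.single_zero]
      rintro rfl
      exact h (tsub_add_cancel_of_le h')
    · rfl

theorem component_apply (z : ChainModule k Δ i) (σ : Faces Δ i) (h : label σ.1 ≤ m) :
    component k Δ i m z σ.1 = (z σ).coeff (m - label σ.1) := by
  induction z using Finsupp.induction_linear with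
  | zero => simp
  | add f g hf hg => simp [hf, hg]
  | single τ p =>
    rw [component_single]
    by_cases hτ : τ = σ
    · subst hτ; simp [h]
    · have : τ.1 ≠ σ.1 := fun h => hτ (Subtype.ext h)
      rw [Finsupp.single_eq_of_ne (Ne.symm hτ)]
      split_ifs <;> simp [this]

theorem component_mem_chains (z : ChainModule k Δ i) :
    component k Δ i m z ∈ chains k (facesBelow Δ m) (i + 1) := by
  induction z using Finsupp.induction_linear with
  | zero => simp
  | add f g hf hg => rw [map_add]; exact Submodule.add_mem _ hf hg
  | single τ p =>
    rw [component_single]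
    split_ifs with h
    · exact single_mem_chains (Or.inr ⟨τ.2.1, h⟩) τ.2.2 _
    · exact Submodule.zero_mem _

theorem chainModule_ext {z : ChainModule k Δ i} (h : ∀ m, component k Δ i m z = 0) : z = 0 := by
  ext σ a
  have := DFunLike.congr_fun (h (a + label σ.1)) σ.1
  rw [component_apply _ _ le_add_self, add_tsub_cancel_right] at this
  simpa using this

/-- Two `k`-linear maps agreeing on the monomial multiples of the basis elements agree. -/
theorem chainModule_hom_ext {M : Type*} [AddCommGroup M] [Module k M]
    {f g : ChainModule k Δ i →ₗ[k] M}
    (h : ∀ σ a c, f (Finsupp.single σ (MvPolynomial.monomial a c))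
      = g (Finsupp.single σ (MvPolynomial.monomial a c))) : f = g := by
  refine Finsupp.lhom_ext fun σ p => ?_
  induction p using MvPolynomial.induction_on' with
  | monomial a c => exact h σ a c
  | add p q hp hq => rw [Finsupp.single_add, map_add, map_add, hp, hq]

theorem boundary_single_monomial (σ : Faces Δ (i + 1)) (a : V →₀ ℕ) (c : k) :
    boundary k Δ i (Finsupp.single σ (MvPolynomial.monomial a c)) =
      ∑ v : {v // v ∈ σ.1}, Finsupp.single (σ.facet v)
        (MvPolynomial.monomial (a + (label σ.1 - label (σ.facet v).1))
          (c * ((sign σ.1 v.1 : ℤ) : k))) := by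
  rw [boundary, Finsupp.linearCombination_single, Finset.smul_sum]
  simp [MvPolynomial.monomial_mul]

/-- The coefficient `m_σ / m_{σ \ v}` makes the differential homogeneous, so only the signs survive
in a fixed degree. -/
theorem component_boundary (z : ChainModule k Δ (i + 1)) :
    component k Δ i m (boundary k Δ i z) = simplexBoundary V k (component k Δ (i + 1) m z) := by
  suffices h : component k Δ i m ∘ₗ (boundary k Δ i).restrictScalars k
      = simplexBoundary V k ∘ₗ component k Δ (i + 1) m from LinearMap.congr_fun h z
  refine chainModule_hom_ext fun σ a c => ?_
  simp only [LinearMap.comp_apply, LinearMap.restrictScalars_apply, component_single_monomial,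
    boundary_single_monomial, map_sum]
  have h (v : {v // v ∈ σ.1}) : a + (label σ.1 - label (σ.facet v).1) + label (σ.facet v).1
      = a + label σ.1 := by
    rw [add_assoc, tsub_add_cancel_of_le (label_facet_le σ v)]
  simp only [h]
  split_ifs with hm
  · rw [simplexBoundary_single]
    exact Finset.sum_coe_sort σ.1 fun v =>
      Finsupp.single (σ.1.erase v) (c * ((sign σ.1 v : ℤ) : k))
  · simp

/-- In degree `m` the augmentation becomes the boundary from vertices to the empty face, so its
kernel is cut out by the same condition as those of the higher differentials. -/
theorem simplexBoundary_component_zero (z : ChainModule k Δ 0) :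
    simplexBoundary V k (component k Δ 0 m z) =
      Finsupp.single ∅ ((augmentation k Δ z).coeff m) := by
  suffices h : simplexBoundary V k ∘ₗ component k Δ 0 m
      = Finsupp.lsingle ∅ ∘ₗ MvPolynomial.lcoeff k m ∘ₗ (augmentation k Δ).restrictScalars k from
    LinearMap.congr_fun h z
  refine chainModule_hom_ext fun σ a c => ?_
  obtain ⟨v, hv⟩ := Finset.card_eq_one.1 σ.2.2
  simp only [LinearMap.comp_apply, LinearMap.restrictScalars_apply, component_single_monomial,
    augmentation, Finsupp.linearCombination_single, smul_eq_mul, MvPolynomial.monomial_mul,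
    MvPolynomial.lcoeff_apply, MvPolynomial.coeff_monomial, Finsupp.lsingle_apply, mul_one]
  split_ifs with h
  · have h1 : sign {v} v = 1 := by
      have : ¬ WellOrderingRel v v := irrefl v
      simp [sign, Finset.filter_singleton, this]
    rw [simplexBoundary_single, hv, Finset.sum_singleton, h1]
    simp
  · simp

/-- The homogenization, in degree `m`, of a chain. -/
def homogenize (k : Type*) [Field k] (Δ : PreAbstractSimplicialComplex (V →₀ ℕ)) (i : ℕ)
    (m : V →₀ ℕ) : (Finset (V →₀ ℕ) →₀ k) →ₗ[k] ChainModule k Δ i :=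
  Finsupp.lsum k fun σ => if h : σ ∈ Δ ∧ σ.card = i + 1 then
    Finsupp.lsingle (⟨σ, h⟩ : Faces Δ i) ∘ₗ
      (MvPolynomial.monomial (m - label σ) : k →ₗ[k] MvPolynomial V k) else 0

/-- Chains of `Δ_{≤ m}` lift to homogeneous elements of degree `m`, which have no component in any
other degree. -/
theorem component_homogenize {z : Finset (V →₀ ℕ) →₀ k}
    (hz : z ∈ chains k (facesBelow Δ m) (i + 1)) (m' : V →₀ ℕ) :
    component k Δ i m' (homogenize k Δ i m z) = if m = m' then z else 0 := by
  have key : ∀ σ ∈ facesBelow Δ m, σ.card = i + 1 → ∀ c : k,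
      component k Δ i m' (homogenize k Δ i m (Finsupp.single σ c))
        = if m = m' then Finsupp.single σ c else 0 := by
    rintro σ (rfl | ⟨hσ, hm⟩) hn c
    · simp at hn
    · rw [homogenize, Finsupp.lsum_single, dif_pos ⟨hσ, hn⟩]
      exact (component_single_monomial (⟨σ, hσ, hn⟩ : Faces Δ i) _ c).trans
        (by rw [tsub_add_cancel_of_le hm])
  have h := map_mem_of_mem_chains hz
    (component k Δ i m' ∘ₗ homogenize k Δ i m - if m = m' then LinearMap.id else 0) ⊥ (by
      intro σ hσ hn c
      rw [Submodule.mem_bot, LinearMap.sub_apply, LinearMap.comp_apply, key σ hσ hn c]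
      split_ifs <;> simp)
  rw [Submodule.mem_bot, LinearMap.sub_apply, LinearMap.comp_apply, sub_eq_zero] at h
  rw [h]
  split_ifs <;> simp

theorem exists_finset_component_eq_zero (z : ChainModule k Δ i) :
    ∃ T : Finset (V →₀ ℕ), ∀ m ∉ T, component k Δ i m z = 0 := by
  induction z using Finsupp.induction_linear with
  | zero => exact ⟨∅, by simp⟩
  | add f g hf hg =>
    obtain ⟨S, hS⟩ := hf
    obtain ⟨T, hT⟩ := hg
    refine ⟨S ∪ T, fun m hm => ?_⟩
    rw [Finset.mem_union, not_or] at hm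
    rw [map_add, hS m hm.1, hT m hm.2, add_zero]
  | single τ p =>
    refine ⟨p.support.image (· + label τ.1), fun m hm => ?_⟩
    rw [component_single]
    split_ifs with h
    · rw [MvPolynomial.notMem_support_iff.1, Finsupp.single_zero]
      intro h'
      exact hm (Finset.mem_image.2 ⟨_, h', tsub_add_cancel_of_le h⟩)
    · rfl

theorem exists_boundary_eq_iff (z : ChainModule k Δ i) :
    (∃ y, boundary k Δ i y = z) ↔
      ∀ m, ∃ y ∈ chains k (facesBelow Δ m) (i + 2), simplexBoundary V k y = component k Δ i m z := by
  constructor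
  · rintro ⟨y, rfl⟩ m
    exact ⟨_, component_mem_chains y, (component_boundary y).symm⟩
  · intro h
    choose y hy hyz using h
    obtain ⟨T, hT⟩ := exists_finset_component_eq_zero z
    -- Preimages are chosen degree by degree; only finitely many degrees occur in `z`, so their
    -- lifts can be summed.
    refine ⟨∑ m ∈ T, homogenize k Δ (i + 1) m (y m), ?_⟩
    rw [← sub_eq_zero]
    refine chainModule_ext fun m => ?_
    rw [map_sub, component_boundary, map_sum]
    simp only [component_homogenize (hy _), Finset.sum_ite_eq']
    split_ifs with hm
    · rw [hyz, sub_self]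
    · rw [hT m hm]; simp

/-- A simplicial complex supports a free resolution of `I` if and only if its vertices generate `I`
and its subcomplexes `Δ_{≤ m}` are acyclic or empty. -/
theorem supportsFreeResolution_iff {I : Ideal (MvPolynomial V k)} :
    SupportsFreeResolution Δ I ↔ LinearMap.range (augmentation k Δ) = I ∧
      ∀ m, IsAcyclicComplex k (facesBelow Δ m) := by
  have hb (i : ℕ) (z : ChainModule k Δ (i + 1)) : boundary k Δ i z = 0 ↔
      ∀ m, simplexBoundary V k (component k Δ (i + 1) m z) = 0 := by
    refine ⟨fun h m => by rw [← component_boundary, h, map_zero], fun h => ?_⟩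
    exact chainModule_ext fun m => by rw [component_boundary, h]
  have ha (z : ChainModule k Δ 0) : augmentation k Δ z = 0 ↔
      ∀ m, simplexBoundary V k (component k Δ 0 m z) = 0 := by
    simp only [simplexBoundary_component_zero, Finsupp.single_eq_zero]
    exact ⟨fun h m => by rw [h]; simp, fun h => MvPolynomial.ext _ _ (by simpa using h)⟩
  have key (i : ℕ) : (∀ z : ChainModule k Δ i,
      (∀ m, simplexBoundary V k (component k Δ i m z) = 0) ↔ ∃ y, boundary k Δ i y = z) ↔
      ∀ m, ∀ z ∈ chains k (facesBelow Δ m) (i + 1), simplexBoundary V k z = 0 →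
        ∃ y ∈ chains k (facesBelow Δ m) (i + 2), simplexBoundary V k y = z := by
    simp only [exists_boundary_eq_iff]
    constructor
    · intro h m z hz hz0
      have h1 := component_homogenize hz
      obtain ⟨y, hy, hyz⟩ := (h (homogenize k Δ i m z)).1 (fun m' => by
        rw [h1]; split_ifs <;> simp [hz0]) m
      rw [h1, if_pos rfl] at hyz
      exact ⟨y, hy, hyz⟩
    · intro h z
      refine ⟨fun h0 m => h m _ (component_mem_chains z) (h0 m), fun h0 m => ?_⟩
      obtain ⟨y, -, hyz⟩ := h0 m
      rw [← hyz, simplexBoundary_simplexBoundary]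
  unfold SupportsFreeResolution Function.Exact IsAcyclicComplex
  simp only [ha, hb, Set.mem_range, key]
  refine and_congr_right fun _ => ⟨fun h m n => ?_, fun h => ⟨fun m => h m 0, fun i m => h m _⟩⟩
  cases n with
  | zero => exact h.1 m
  | succ n => exact h.2 n m

end ScarfIdeal
end

noncomputable section
namespace ScarfIdeal
variable {V : Type*}
open scoped Classical
variable {k : Type*} [Field k]

/-! ### Faces of the Scarf complex -/

variable {I : Ideal (MvPolynomial V k)}

theorem le_label {σ : Finset (V →₀ ℕ)} {g : V →₀ ℕ} (h : g ∈ σ) : g ≤ label σ :=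
  Finset.le_sup (f := id) h

theorem label_le_iff {σ : Finset (V →₀ ℕ)} {m : V →₀ ℕ} : label σ ≤ m ↔ ∀ g ∈ σ, g ≤ m :=
  Finset.sup_le_iff

theorem label_singleton (g : V →₀ ℕ) : label {g} = g := Finset.sup_singleton

theorem label_pair (g h : V →₀ ℕ) : label {g, h} = g ⊔ h := by
  simp [label]

theorem eq_of_mem_gens_of_le {g h : V →₀ ℕ} (hg : g ∈ gens I) (hh : h ∈ gens I) (hle : g ≤ h) :
    g = h :=
  le_antisymm hle (hh.2 hg.1 hle)

/-- Uniqueness of the label splits into two conditions: no generator can be added to the face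
without changing the label, and none can be removed. The nonemptiness guard is there because the
empty set is not a face of the Taylor complex. -/
theorem mem_scarfComplex_iff {σ : Finset (V →₀ ℕ)} :
    σ ∈ scarfComplex I ↔ σ.Nonempty ∧ (∀ g ∈ σ, g ∈ gens I) ∧
      (∀ f ∈ gens I, f ≤ label σ → f ∈ σ) ∧
      ∀ g ∈ σ, (σ.erase g).Nonempty → ¬ g ≤ label (σ.erase g) := by
  constructor
  · rintro ⟨⟨h1, h2⟩, h3⟩
    refine ⟨h1, h2, fun f hf hfl => ?_, fun g hg hne hle => ?_⟩
    · have := h3 (insert f σ) ⟨Finset.insert_nonempty _ _, by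
        intro x hx
        rcases Finset.mem_insert.1 (Finset.mem_coe.1 hx) with rfl | hx
        · exact hf
        · exact h2 hx⟩ (by simpa [label, Finset.sup_insert] using hfl)
      rw [← this]
      exact Finset.mem_insert_self _ _
    · have := h3 (σ.erase g) ⟨hne, fun x hx => h2 (Finset.mem_of_mem_erase hx)⟩ (by
        refine le_antisymm (Finset.sup_mono (Finset.erase_subset _ _)) (label_le_iff.2 ?_)
        intro x hx
        by_cases hxg : x = g
        · exact hxg ▸ hle
        · exact le_label (Finset.mem_erase.2 ⟨hxg, hx⟩))
      exact Finset.erase_eq_self.1 this hg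
  · rintro ⟨h1, h2, h3, h4⟩
    refine ⟨⟨h1, h2⟩, fun τ hτ hlab => ?_⟩
    have hsub : τ ⊆ σ := fun x hx => h3 x (hτ.2 hx) (hlab ▸ le_label hx)
    refine Finset.Subset.antisymm hsub fun g hg => ?_
    by_contra hgτ
    have hτe : τ ⊆ σ.erase g := fun x hx =>
      Finset.mem_erase.2 ⟨fun h => hgτ (h ▸ hx), hsub hx⟩
    exact h4 g hg (hτ.1.mono hτe) (((le_label hg).trans hlab.ge).trans (Finset.sup_mono hτe))

theorem singleton_mem_scarfComplex {g : V →₀ ℕ} (hg : g ∈ gens I) : {g} ∈ scarfComplex I := by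
  refine mem_scarfComplex_iff.2 ⟨Finset.singleton_nonempty g, by simpa using hg, ?_, ?_⟩
  · intro f hf hfl
    rw [label_singleton] at hfl
    simpa using eq_of_mem_gens_of_le hf hg hfl
  · intro h hh hne
    simp [Finset.mem_singleton.1 hh] at hne

theorem pair_mem_scarfComplex_iff {g h : V →₀ ℕ} (hg : g ∈ gens I) (hh : h ∈ gens I) (hgh : g ≠ h) :
    {g, h} ∈ scarfComplex I ↔ ∀ f ∈ gens I, f ≤ g ⊔ h → f = g ∨ f = h := by
  rw [mem_scarfComplex_iff, label_pair]
  constructor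
  · rintro ⟨-, -, h3, -⟩ f hf hfl
    simpa using h3 f hf hfl
  · intro H
    refine ⟨Finset.insert_nonempty _ _, ?_, by simpa using H, ?_⟩
    · intro x hx
      rcases Finset.mem_insert.1 hx with rfl | hx
      · exact hg
      · exact Finset.mem_singleton.1 hx ▸ hh
    · intro x hx _ hle
      rcases Finset.mem_insert.1 hx with rfl | hx
      · rw [Finset.erase_insert (by simpa using hgh), label_singleton] at hle
        exact hgh (eq_of_mem_gens_of_le hg hh hle)
      · rw [Finset.mem_singleton.1 hx, Finset.pair_comm, Finset.erase_insert (by simpa using hgh.symm),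
          label_singleton] at hle
        exact hgh (eq_of_mem_gens_of_le hh hg hle).symm

theorem range_augmentation_scarfComplex :
    LinearMap.range (augmentation k (scarfComplex I)) =
      Ideal.span ((fun a => MvPolynomial.monomial a (1 : k)) '' gens I) := by
  rw [augmentation, Finsupp.range_linearCombination, Ideal.span]
  congr 1
  ext p
  simp only [Set.mem_range, Set.mem_image]
  constructor
  · rintro ⟨σ, rfl⟩
    obtain ⟨g, hg⟩ := Finset.card_eq_one.1 σ.2.2
    refine ⟨g, (mem_scarfComplex_iff.1 σ.2.1).2.1 g (by simp [hg]), ?_⟩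
    rw [hg, label_singleton]
  · rintro ⟨g, hg, rfl⟩
    refine ⟨⟨{g}, singleton_mem_scarfComplex hg, Finset.card_singleton g⟩, ?_⟩
    simp only [label_singleton]

/-- A complex of free modules on the faces of the Scarf complex is automatically minimal. -/
theorem supportsMinimalFreeResolution_scarfComplex_iff :
    SupportsMinimalFreeResolution (scarfComplex I) I ↔ IsScarf I := by
  refine ⟨fun h => h.1, fun h => ⟨h, fun i x => ?_⟩⟩
  suffices H : ∀ τ, boundary k (scarfComplex I) i x τ ∈
      Ideal.span (Set.range (MvPolynomial.X : V → MvPolynomial V k)) from H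
  induction x using Finsupp.induction_linear with
  | zero => simp
  | add f g hf hg => intro τ; rw [map_add, Finsupp.add_apply]; exact Ideal.add_mem _ (hf τ) (hg τ)
  | single σ p =>
    intro τ
    rw [boundary, Finsupp.linearCombination_single, Finsupp.smul_apply, Finsupp.finsetSum_apply]
    refine Submodule.smul_mem _ _ (Submodule.sum_mem _ fun v _ => ?_)
    rw [Finsupp.single_apply]
    split_ifs
    · rw [← Set.image_univ, MvPolynomial.mem_ideal_span_X_image]
      intro a ha
      rw [MvPolynomial.mem_support_iff, MvPolynomial.coeff_monomial] at ha
      split_ifs at ha with hav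
      · have hne : label σ.1 - label (σ.facet v).1 ≠ 0 := by
          intro h0
          rw [tsub_eq_zero_iff_le] at h0
          have hne : (σ.1.erase v.1).Nonempty :=
            (mem_scarfComplex_iff.1 (σ.facet v).2.1).1
          exact (mem_scarfComplex_iff.1 σ.2.1).2.2.2 v.1 v.2 hne ((le_label v.2).trans h0)
        obtain ⟨j, hj⟩ := Finsupp.ne_iff.1 hne
        exact ⟨j, trivial, by simpa [← hav] using hj⟩
      · exact absurd rfl ha
    · exact Ideal.zero_mem _

theorem isScarf_iff (hI : Ideal.span ((fun a => MvPolynomial.monomial a (1 : k)) '' gens I) = I) :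
    IsScarf I ↔ ∀ m, IsAcyclicComplex k (facesBelow (scarfComplex I) m) := by
  rw [IsScarf, supportsFreeResolution_iff, range_augmentation_scarfComplex]
  exact and_iff_right hI

/-! ### Obstructions to acyclicity -/

theorem exists_of_simplexBoundary_apply_ne_zero {y : Finset (V →₀ ℕ) →₀ k}
    {τ : Finset (V →₀ ℕ)} (h : simplexBoundary V k y τ ≠ 0) :
    ∃ σ, y σ ≠ 0 ∧ ∃ v ∈ σ, σ.erase v = τ := by
  by_contra! H
  refine h ?_
  rw [← Finsupp.sum_single y, Finsupp.sum, map_sum, Finsupp.finsetSum_apply]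
  refine Finset.sum_eq_zero fun σ hσ => ?_
  rw [simplexBoundary_single, Finsupp.finsetSum_apply]
  exact Finset.sum_eq_zero fun v hv =>
    Finsupp.single_eq_of_ne (H σ (Finsupp.mem_support_iff.1 hσ) v hv).symm

theorem sign_singleton (v : V →₀ ℕ) : sign {v} v = 1 := by
  have : ¬ WellOrderingRel v v := irrefl v
  simp [sign, Finset.filter_singleton, this]

theorem sign_ne_zero (σ : Finset (V →₀ ℕ)) (v : V →₀ ℕ) : ((sign σ v : ℤ) : k) ≠ 0 := by
  simp [sign]

/-- An acyclic complex with at least two vertices has no isolated vertex. -/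
theorem IsAcyclicComplex.exists_edge {K : Set (Finset (V →₀ ℕ))} (hK : IsAcyclicComplex k K)
    {g h : V →₀ ℕ} (hg : {g} ∈ K) (hh : {h} ∈ K) (hgh : g ≠ h) : ∃ f, f ≠ g ∧ {g, f} ∈ K := by
  obtain ⟨y, hy, hyz⟩ := hK 0 (Finsupp.single {g} 1 - Finsupp.single {h} 1)
    (Submodule.sub_mem _ (single_mem_chains hg (Finset.card_singleton g) _)
      (single_mem_chains hh (Finset.card_singleton h) _))
    (by simp [simplexBoundary_single, sign_singleton])
  obtain ⟨σ, hσ, v, hv, hvσ⟩ := exists_of_simplexBoundary_apply_ne_zero (k := k) (y := y) (τ := {g}) (by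
    rw [hyz, Finsupp.sub_apply, Finsupp.single_eq_same, Finsupp.single_eq_of_ne (by simpa using hgh)]
    simp)
  refine ⟨v, ?_, ?_⟩
  · rintro rfl
    exact Finset.notMem_erase v σ (by rw [hvσ]; simp)
  · rw [Finset.pair_comm, ← hvσ, Finset.insert_erase hv]
    exact (mem_chains.1 hy σ hσ).1

theorem simplexBoundary_edge {u v : V →₀ ℕ} (h : u ≠ v) :
    simplexBoundary V k (Finsupp.single {u, v} ((sign {u, v} u : ℤ) : k)) =
      Finsupp.single {v} 1 - Finsupp.single {u} 1 := by
  have h1 := sign_swap (Finset.mem_insert_self u {v})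
    (Finset.mem_insert_of_mem (Finset.mem_singleton_self v)) h
  have hu : ({u, v} : Finset (V →₀ ℕ)).erase u = {v} := Finset.erase_insert (by simpa using h)
  have hv : ({u, v} : Finset (V →₀ ℕ)).erase v = {u} := by
    rw [Finset.pair_comm]; exact Finset.erase_insert (by simpa using h.symm)
  rw [hu, hv, sign_singleton, sign_singleton, mul_one, mul_one] at h1
  rw [simplexBoundary_single, Finset.sum_pair h, hu, hv, ← Int.cast_mul, ← Int.cast_mul,
    sign_mul_self, h1, neg_mul, sign_mul_self, sub_eq_add_neg, ← Finsupp.single_neg]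
  simp

/-- In an acyclic complex, an edge lying on a cycle of edges is contained in a triangle. -/
theorem IsAcyclicComplex.exists_triangle {K : Set (Finset (V →₀ ℕ))} (hK : IsAcyclicComplex k K)
    {g h : V →₀ ℕ} (hgh : g ≠ h) (he : {g, h} ∈ K)
    (hc : Relation.ReflTransGen (fun u v => u ≠ v ∧ {u, v} ∈ K ∧
      ({u, v} : Finset (V →₀ ℕ)) ≠ {g, h}) h g) :
    ∃ f, f ≠ g ∧ f ≠ h ∧ {f, g, h} ∈ K := by
  -- The path from `h` to `g'` is turned into a 1-chain from `h` to `g'` in which the edge `{g, h}`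
  -- has coefficient zero. Closed up by that edge, it becomes a cycle whose coefficient there is
  -- nonzero, so any filling must use a triangle on it.
  have key : ∀ g', Relation.ReflTransGen (fun u v => u ≠ v ∧ {u, v} ∈ K ∧
      ({u, v} : Finset (V →₀ ℕ)) ≠ {g, h}) h g' → ∃ z ∈ chains k K 2, z {g, h} = 0 ∧
      simplexBoundary V k z = Finsupp.single {g'} 1 - Finsupp.single {h} 1 := by
    intro g' hg'
    induction hg' with
    | refl => exact ⟨0, Submodule.zero_mem _, rfl, by simp⟩
    | @tail b c _ hbc ih =>
      obtain ⟨z, hz, hz0, hzb⟩ := ih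
      refine ⟨z + Finsupp.single {b, c} ((sign {b, c} b : ℤ) : k),
        Submodule.add_mem _ hz (single_mem_chains hbc.2.1 (Finset.card_pair hbc.1) _), ?_, ?_⟩
      · rw [Finsupp.add_apply, hz0, Finsupp.single_eq_of_ne hbc.2.2.symm, add_zero]
      · rw [map_add, hzb, simplexBoundary_edge hbc.1]
        abel
  obtain ⟨z, hz, hz0, hzb⟩ := key g hc
  obtain ⟨y, hy, hyz⟩ := hK 1 (z + Finsupp.single {g, h} ((sign {g, h} g : ℤ) : k))
    (Submodule.add_mem _ hz (single_mem_chains he (Finset.card_pair hgh) _))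
    (by rw [map_add, hzb, simplexBoundary_edge hgh]; abel)
  obtain ⟨σ, hσ, v, hv, hvσ⟩ :=
    exists_of_simplexBoundary_apply_ne_zero (k := k) (y := y) (τ := {g, h}) (by
      rw [hyz, Finsupp.add_apply, hz0, Finsupp.single_eq_same, zero_add]
      exact sign_ne_zero _ _)
  have hvn : v ∉ ({g, h} : Finset (V →₀ ℕ)) := hvσ ▸ Finset.notMem_erase v σ
  simp only [Finset.mem_insert, Finset.mem_singleton, not_or] at hvn
  refine ⟨v, hvn.1, hvn.2, ?_⟩
  rw [← hvσ, Finset.insert_erase hv]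
  exact (mem_chains.1 hy σ hσ).1

theorem mem_facesBelow_iff {Δ : PreAbstractSimplicialComplex (V →₀ ℕ)} {m : V →₀ ℕ}
    {σ : Finset (V →₀ ℕ)} (h : σ.Nonempty) : σ ∈ facesBelow Δ m ↔ σ ∈ Δ ∧ label σ ≤ m := by
  simp [facesBelow, h.ne_empty]

/-- If exactly three generators divide `g₀ ∨ g₁ = g₀ ∨ g₂`, then `g₀` is an isolated vertex. -/
theorem not_isScarf_of_isolated
    (hI : Ideal.span ((fun a => MvPolynomial.monomial a (1 : k)) '' gens I) = I)
    {g₀ g₁ g₂ : V →₀ ℕ} (h₀ : g₀ ∈ gens I) (h₁ : g₁ ∈ gens I) (h₂ : g₂ ∈ gens I) (h01 : g₀ ≠ g₁)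
    (h02 : g₀ ≠ g₂) (h12 : g₁ ≠ g₂) (hle₂ : g₂ ≤ g₀ ⊔ g₁) (hle₁ : g₁ ≤ g₀ ⊔ g₂)
    (H : ∀ f ∈ gens I, f ≤ g₀ ⊔ g₁ → f = g₀ ∨ f = g₁ ∨ f = g₂) : ¬ IsScarf I := by
  intro hS
  have hK := (isScarf_iff hI).1 hS (g₀ ⊔ g₁)
  obtain ⟨f, hf, hfK⟩ := hK.exists_edge (g := g₀) (h := g₁)
    (Or.inr ⟨singleton_mem_scarfComplex h₀, by simp [label_singleton]⟩)
    (Or.inr ⟨singleton_mem_scarfComplex h₁, by simp [label_singleton]⟩) h01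
  rw [mem_facesBelow_iff (by simp), label_pair] at hfK
  obtain ⟨hfK, hle⟩ := hfK
  have hfg := (mem_scarfComplex_iff.1 hfK).2.1 f (by simp)
  have hp := (pair_mem_scarfComplex_iff h₀ hfg hf.symm).1 hfK
  -- An edge from `g₀` could only go to `g₁` or `g₂`, but then the third generator would divide its
  -- label.
  rcases H f hfg (le_sup_right.trans hle) with rfl | rfl | rfl
  · exact hf rfl
  · rcases hp g₂ h₂ hle₂ with h | h
    · exact h02 h.symm
    · exact h12 h.symm
  · rcases hp g₁ h₁ hle₁ with h | h
    · exact h01 h.symm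
    · exact h12 h

/-- If the generators dividing `m` form a cycle of edges of the Scarf complex one of whose edges
lies in no triangle, then the ideal is not Scarf. -/
theorem not_isScarf_of_hole
    (hI : Ideal.span ((fun a => MvPolynomial.monomial a (1 : k)) '' gens I) = I) {r : ℕ}
    (g : Fin (r + 3) → V →₀ ℕ) (m : V →₀ ℕ) (hinj : Function.Injective g) (hg : ∀ i, g i ∈ gens I)
    (hm : ∀ i, g i ≤ m) (H : ∀ f ∈ gens I, f ≤ m → ∃ i, f = g i)
    (hcon : ∀ i l, g l ≤ g i ⊔ g (i + 1) → l = i ∨ l = i + 1)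
    (hnon : ∀ l, l ≠ 0 → l ≠ 1 → ∃ p, p ≠ l ∧
      (p ≠ 0 ∧ g p ≤ g 0 ⊔ g l ∨ p ≠ 1 ∧ g p ≤ g 1 ⊔ g l)) : ¬ IsScarf I := by
  intro hS
  have hK := (isScarf_iff hI).1 hS m
  have hne (i : Fin (r + 3)) : i ≠ i + 1 := by simp
  have hedge (i : Fin (r + 3)) : {g i, g (i + 1)} ∈ facesBelow (scarfComplex I) m := by
    rw [mem_facesBelow_iff (by simp), label_pair, pair_mem_scarfComplex_iff (hg _) (hg _)
      (hinj.ne (hne i))]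
    refine ⟨fun f hf hle => ?_, sup_le (hm _) (hm _)⟩
    obtain ⟨l, rfl⟩ := H f hf (hle.trans (sup_le (hm _) (hm _)))
    exact (hcon i l hle).imp (congrArg g) (congrArg g)
  have hstep (i : Fin (r + 3)) (hi : i ≠ 0) : g i ≠ g (i + 1) ∧
      {g i, g (i + 1)} ∈ facesBelow (scarfComplex I) m ∧
      ({g i, g (i + 1)} : Finset (V →₀ ℕ)) ≠ {g 0, g 1} := by
    refine ⟨hinj.ne (hne i), hedge i, fun h => ?_⟩
    have h1 : g i ∈ ({g 0, g 1} : Finset (V →₀ ℕ)) := h ▸ Finset.mem_insert_self _ _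
    have h2 : g (i + 1) ∈ ({g 0, g 1} : Finset (V →₀ ℕ)) :=
      h ▸ Finset.mem_insert_of_mem (Finset.mem_singleton_self _)
    simp only [Finset.mem_insert, Finset.mem_singleton, hinj.eq_iff, hi, false_or] at h1 h2
    subst h1
    rcases h2 with h2 | h2
    · have := congrArg Fin.val h2
      simp [Fin.val_add, Nat.mod_eq_of_lt (show 1 + 1 < r + 3 by omega)] at this
    · simp at h2
  -- Going round the cycle from `g 1` the long way, avoiding the edge between `g 0` and `g 1`; the
  -- wrap-around to `g 0` is added in `hcyc`.
  have hpath : ∀ i : ℕ, ∀ hi : i + 1 < r + 3, Relation.ReflTransGen (fun u v => u ≠ v ∧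
      {u, v} ∈ facesBelow (scarfComplex I) m ∧ ({u, v} : Finset (V →₀ ℕ)) ≠ {g 0, g 1})
      (g 1) (g ⟨i + 1, hi⟩) := by
    intro i
    induction i with
    | zero => intro hi; exact Relation.ReflTransGen.refl
    | succ i ih =>
      intro hi
      refine (ih (by omega)).tail ?_
      have h1 : (⟨i + 1 + 1, hi⟩ : Fin (r + 3)) = ⟨i + 1, by omega⟩ + 1 := by
        ext; simp [Fin.val_add, Nat.mod_eq_of_lt hi]
      rw [h1]
      exact hstep _ (by simp [Fin.ext_iff])
  have hlast : (Fin.last (r + 2)) + 1 = 0 := by simp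
  have hcyc := (hpath (r + 1) (by omega)).tail
    (by have := hstep (Fin.last (r + 2)) (by simp [Fin.ext_iff]); rw [hlast] at this; exact this)
  have h01 : g 0 ≠ g 1 := hinj.ne (by simp)
  obtain ⟨f, hf0, hf1, hfK⟩ := hK.exists_triangle h01 (by simpa using hedge 0) hcyc
  rw [mem_facesBelow_iff (by simp)] at hfK
  obtain ⟨hfK, hle⟩ := hfK
  obtain ⟨l, rfl⟩ := H f ((mem_scarfComplex_iff.1 hfK).2.1 f (by simp))
    ((le_label (by simp)).trans hle)
  have hsub (j : Fin (r + 3)) (hj : g j ∈ ({g l, g 0, g 1} : Finset (V →₀ ℕ))) (hjl : g l ≠ g j) :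
      ∀ f ∈ gens I, f ≤ g j ⊔ g l → f = g j ∨ f = g l := by
    rw [← pair_mem_scarfComplex_iff (hg _) (hg _) hjl.symm]
    refine ((scarfComplex I).isRelLowerSet_faces hfK).2 ?_ (by simp)
    intro x hx
    rcases Finset.mem_insert.1 hx with rfl | hx
    · exact hj
    · rw [Finset.mem_singleton.1 hx]; simp
  -- The third vertex `g l` of the triangle would be joined to both `g 0` and `g 1`, but `hnon`
  -- makes one of these pairs a non-face.
  obtain ⟨p, hpl, ⟨hp, hple⟩ | ⟨hp, hple⟩⟩ := hnon l (fun h => hf0 (h ▸ rfl)) (fun h => hf1 (h ▸ rfl))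
  · rcases hsub 0 (by simp) hf0 (g p) (hg p) hple with h | h
    · exact hp (hinj h)
    · exact hpl (hinj h)
  · rcases hsub 1 (by simp) hf1 (g p) (hg p) hple with h | h
    · exact hp (hinj h)
    · exact hpl (hinj h)

end ScarfIdeal
end

noncomputable section
namespace ScarfIdeal
variable {V : Type*}
open scoped Classical
variable {k : Type*} [Field k]

/-! ### Generators of the powers of an edge ideal -/

/-- The sums of `t` edges, each edge being viewed as the sum of its two ends. -/
def edgeSums (G : SimpleGraph V) : ℕ → Set (V →₀ ℕ)
  | 0 => {0}
  | t + 1 => {s | ∃ u v, G.Adj u v ∧ ∃ r ∈ edgeSums G t,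
      s = Finsupp.single u 1 + Finsupp.single v 1 + r}

variable {G : SimpleGraph V}

theorem mem_edgeSums_one {s : V →₀ ℕ} : s ∈ edgeSums G 1 ↔
    ∃ u v, G.Adj u v ∧ s = Finsupp.single u 1 + Finsupp.single v 1 := by
  simp [edgeSums]

theorem degree_of_mem_edgeSums {t : ℕ} {s : V →₀ ℕ} (h : s ∈ edgeSums G t) :
    s.degree = 2 * t := by
  induction t generalizing s with
  | zero => simp_all [edgeSums]
  | succ t ih =>
    obtain ⟨u, v, -, r, hr, rfl⟩ := h
    rw [map_add, map_add, ih hr, Finsupp.degree_single, Finsupp.degree_single]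
    ring

theorem eq_of_le_of_degree_eq {s r : V →₀ ℕ} (h : s ≤ r) (hd : s.degree = r.degree) : s = r := by
  obtain ⟨q, rfl⟩ := exists_add_of_le h
  rw [map_add, left_eq_add, Finsupp.degree_eq_zero_iff] at hd
  rw [hd, add_zero]

theorem edgeIdeal_pow_eq_span (k : Type*) [Field k] (G : SimpleGraph V) (t : ℕ) :
    edgeIdeal k G ^ t =
      Ideal.span ((fun a => MvPolynomial.monomial a (1 : k)) '' edgeSums G t) := by
  induction t with
  | zero => simp [edgeSums, Ideal.one_eq_top]
  | succ t ih =>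
    rw [pow_succ', ih, edgeIdeal, Ideal.span_mul_span']
    congr 1
    ext p
    simp only [Set.mem_mul, Set.mem_image, Set.mem_ofPred_eq, edgeSums]
    constructor
    · rintro ⟨_, ⟨u, v, h, rfl⟩, _, ⟨r, hr, rfl⟩, rfl⟩
      exact ⟨_, ⟨u, v, h, r, hr, rfl⟩, by simp [MvPolynomial.X, MvPolynomial.monomial_mul]⟩
    · rintro ⟨_, ⟨u, v, h, r, hr, rfl⟩, rfl⟩
      exact ⟨_, ⟨u, v, h, rfl⟩, _, ⟨r, hr, rfl⟩, by simp [MvPolynomial.X, MvPolynomial.monomial_mul]⟩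

theorem monomial_mem_edgeIdeal_pow {t : ℕ} {a : V →₀ ℕ} :
    MvPolynomial.monomial a (1 : k) ∈ edgeIdeal k G ^ t ↔ ∃ s ∈ edgeSums G t, s ≤ a := by
  rw [edgeIdeal_pow_eq_span, MvPolynomial.mem_ideal_span_monomial_image]
  simp [MvPolynomial.support_monomial]

/-- All sums of `t` edges have degree `2 * t`, so none properly divides another and each is a
minimal generator. -/
theorem gens_edgeIdeal_pow (t : ℕ) : gens (edgeIdeal k G ^ t) = edgeSums G t := by
  ext a
  simp only [gens, Set.mem_ofPred_eq, Minimal, monomial_mem_edgeIdeal_pow]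
  constructor
  · rintro ⟨⟨s, hs, hsa⟩, h⟩
    rwa [← le_antisymm hsa (h ⟨s, hs, le_rfl⟩ hsa)]
  · refine fun h => ⟨⟨a, h, le_rfl⟩, ?_⟩
    rintro b ⟨s, hs, hsb⟩ hba
    have := eq_of_le_of_degree_eq (hsb.trans hba)
      (by rw [degree_of_mem_edgeSums h, degree_of_mem_edgeSums hs])
    exact this ▸ hsb

theorem span_gens_edgeIdeal_pow (t : ℕ) :
    Ideal.span ((fun a => MvPolynomial.monomial a (1 : k)) '' gens (edgeIdeal k G ^ t)) =
      edgeIdeal k G ^ t := by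
  rw [gens_edgeIdeal_pow, edgeIdeal_pow_eq_span]

/-! ### Monomials in finitely many chosen variables -/

/-- The monomial with exponent `x i` at the vertex `f i`. -/
def monomialOn {n : ℕ} (f : Fin n ↪ V) (x : Fin n → ℕ) : V →₀ ℕ :=
  (Finsupp.equivFunOnFinite.symm x).embDomain f

variable {n : ℕ} {f : Fin n ↪ V}

theorem monomialOn_apply (x : Fin n → ℕ) (i : Fin n) : monomialOn f x (f i) = x i := by
  simp [monomialOn]

theorem monomialOn_injective : Function.Injective (monomialOn f) := fun x y h => by
  ext i
  rw [← monomialOn_apply (f := f) x, h, monomialOn_apply]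

theorem eq_monomialOn_of_le {s : V →₀ ℕ} {y : Fin n → ℕ} (h : s ≤ monomialOn f y) :
    s = monomialOn f fun i => s (f i) := by
  ext v
  by_cases hv : v ∈ Set.range f
  · obtain ⟨i, rfl⟩ := hv
    rw [monomialOn_apply]
  · have := h v
    rw [monomialOn, Finsupp.embDomain_of_notMem_range _ _ _ hv] at this ⊢
    exact Nat.le_zero.1 this

theorem monomialOn_le_iff {x y : Fin n → ℕ} : monomialOn f x ≤ monomialOn f y ↔ x ≤ y := by
  constructor
  · intro h i
    have := h (f i)
    rwa [monomialOn_apply, monomialOn_apply] at this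
  · intro h v
    by_cases hv : v ∈ Set.range f
    · obtain ⟨i, rfl⟩ := hv
      rw [monomialOn_apply, monomialOn_apply]
      exact h i
    · rw [monomialOn, Finsupp.embDomain_of_notMem_range _ _ _ hv]
      exact Nat.zero_le _

theorem monomialOn_sup (x y : Fin n → ℕ) :
    monomialOn f (x ⊔ y) = monomialOn f x ⊔ monomialOn f y := by
  ext v
  rw [Finsupp.sup_apply]
  by_cases hv : v ∈ Set.range f
  · obtain ⟨i, rfl⟩ := hv
    simp only [monomialOn_apply, Pi.sup_apply]
  · simp only [monomialOn, Finsupp.embDomain_of_notMem_range _ _ _ hv, le_refl, sup_of_le_left]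

theorem monomialOn_add (x y : Fin n → ℕ) :
    monomialOn f (x + y) = monomialOn f x + monomialOn f y := by
  ext v
  rw [Finsupp.add_apply]
  by_cases hv : v ∈ Set.range f
  · obtain ⟨i, rfl⟩ := hv
    simp only [monomialOn_apply, Pi.add_apply]
  · simp only [monomialOn, Finsupp.embDomain_of_notMem_range _ _ _ hv, add_zero]

theorem monomialOn_zero : monomialOn f 0 = 0 := by
  ext v
  by_cases hv : v ∈ Set.range f
  · obtain ⟨i, rfl⟩ := hv
    rw [monomialOn_apply]; rfl
  · rw [monomialOn, Finsupp.embDomain_of_notMem_range _ _ _ hv]; rfl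

theorem single_eq_monomialOn (i : Fin n) :
    Finsupp.single (f i) 1 = monomialOn f (Pi.single i 1) := by
  have : Finsupp.equivFunOnFinite.symm (Pi.single i (1 : ℕ)) = Finsupp.single i 1 := by
    ext j; simp
  rw [monomialOn, this, Finsupp.embDomain_single]

theorem degree_monomialOn (x : Fin n → ℕ) : (monomialOn f x).degree = ∑ i, x i := by
  rw [monomialOn, Finsupp.embDomain_eq_mapDomain, Finsupp.degree_mapDomain, Finsupp.degree_eq_sum]
  simp

theorem monomialOn_add_mem_edgeSums {t : ℕ} {i j : Fin n} (hij : G.Adj (f i) (f j))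
    {x : Fin n → ℕ} (hx : monomialOn f x ∈ edgeSums G t) :
    monomialOn f (Pi.single i 1 + Pi.single j 1 + x) ∈ edgeSums G (t + 1) :=
  ⟨f i, f j, hij, _, hx, by rw [monomialOn_add, monomialOn_add, single_eq_monomialOn,
    single_eq_monomialOn]⟩

theorem monomialOn_nsmul_mem_edgeSums {i j : Fin n} (hij : G.Adj (f i) (f j)) (t : ℕ) :
    monomialOn f (t • (Pi.single i 1 + Pi.single j 1)) ∈ edgeSums G t := by
  induction t with
  | zero => rw [zero_smul, monomialOn_zero]; rfl
  | succ t ih => rw [succ_nsmul']; exact monomialOn_add_mem_edgeSums hij ih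

/-- A sum of `t` edges each of weight `d` has weight `d * t`. -/
theorem sum_mul_eq_of_mem_edgeSums {c : Fin n → ℕ} {d : ℕ}
    (hc : ∀ i j, G.Adj (f i) (f j) → c i + c j = d) {t : ℕ} {x : Fin n → ℕ}
    (hx : monomialOn f x ∈ edgeSums G t) : ∑ i, c i * x i = d * t := by
  induction t generalizing x with
  | zero =>
    have : x = 0 := monomialOn_injective (f := f) (by rw [monomialOn_zero]; exact hx)
    simp [this]
  | succ t ih =>
    obtain ⟨u, v, huv, r, hr, hs⟩ := hx
    have hru := eq_monomialOn_of_le (f := f) (s := r) (y := x) (hs ▸ le_add_self)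
    have mem (w : V) (hw : (Finsupp.single w 1 : V →₀ ℕ) ≤ monomialOn f x) : w ∈ Set.range f := by
      by_contra hwf
      have := hw w
      rw [monomialOn, Finsupp.embDomain_of_notMem_range _ _ _ hwf] at this
      simp at this
    obtain ⟨i, rfl⟩ := mem u (hs ▸ le_add_right (le_add_right le_rfl))
    obtain ⟨j, rfl⟩ := mem v (hs ▸ le_add_right le_add_self)
    rw [hru] at hr hs
    rw [single_eq_monomialOn, single_eq_monomialOn, ← monomialOn_add, ← monomialOn_add] at hs
    rw [monomialOn_injective hs]
    simp only [Pi.add_apply, mul_add, Finset.sum_add_distrib, ih hr, Pi.single_apply, mul_ite,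
      mul_one, mul_zero, Finset.sum_ite_eq', Finset.mem_univ, if_true, hc i j huv]
    ring

/-! ### Forbidden subgraphs -/

theorem sum_eq_of_mem_edgeSums {t : ℕ} {x : Fin n → ℕ} (hx : monomialOn f x ∈ edgeSums G t) :
    ∑ i, x i = 2 * t := by
  rw [← degree_monomialOn (f := f), degree_of_mem_edgeSums hx]

/-- With `m = a * (b * c) ^ (t + 1)`, of degree one more than the generators, a generator dividing
`m` is `m` with one variable removed once. This leaves exactly `(bc)^(t+1)`, `ab(bc)^t` and
`ac(bc)^t`, and any two of them have least common multiple `m`. -/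
theorem not_isScarf_of_triangle {a b c : V} (hab : G.Adj a b) (hbc : G.Adj b c) (hac : G.Adj a c)
    (t : ℕ) : ¬ IsScarf (edgeIdeal k G ^ (t + 1)) := by
  let f : Fin 3 ↪ V := ⟨![a, b, c], by
    intro i j; fin_cases i <;> fin_cases j <;> simp [hab.ne, hbc.ne, hac.ne, hab.ne', hbc.ne', hac.ne']⟩
  have h0 : monomialOn f ![0, t + 1, t + 1] ∈ edgeSums G (t + 1) := by
    convert monomialOn_nsmul_mem_edgeSums (f := f) (i := 1) (j := 2) hbc (t + 1) using 2
    ext i; fin_cases i <;> simp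
  have h1 : monomialOn f ![1, t + 1, t] ∈ edgeSums G (t + 1) := by
    convert monomialOn_add_mem_edgeSums (f := f) (i := 0) (j := 1) hab
      (monomialOn_nsmul_mem_edgeSums (f := f) (i := 1) (j := 2) hbc t) using 2
    ext i; fin_cases i <;> simp [add_comm]
  have h2 : monomialOn f ![1, t, t + 1] ∈ edgeSums G (t + 1) := by
    convert monomialOn_add_mem_edgeSums (f := f) (i := 0) (j := 2) hac
      (monomialOn_nsmul_mem_edgeSums (f := f) (i := 1) (j := 2) hbc t) using 2
    ext i; fin_cases i <;> simp [add_comm]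
  rw [← gens_edgeIdeal_pow (k := k)] at h0 h1 h2
  refine not_isScarf_of_isolated (span_gens_edgeIdeal_pow _) h0 h1 h2 ?_ ?_ ?_ ?_ ?_ ?_
  · simp [monomialOn_injective.eq_iff]
  · simp [monomialOn_injective.eq_iff]
  · simp [monomialOn_injective.eq_iff]
  · simp [← monomialOn_sup, monomialOn_le_iff, Pi.le_def, Fin.forall_fin_succ]
  · simp [← monomialOn_sup, monomialOn_le_iff, Pi.le_def, Fin.forall_fin_succ]
  · intro s hs hle
    rw [← monomialOn_sup] at hle
    obtain ⟨x, rfl⟩ : ∃ x, s = monomialOn f x := ⟨_, eq_monomialOn_of_le hle⟩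
    rw [gens_edgeIdeal_pow] at hs
    have hsum := sum_eq_of_mem_edgeSums hs
    rw [monomialOn_le_iff] at hle
    simp only [monomialOn_injective.eq_iff]
    simp [Pi.le_def, Fin.forall_fin_succ] at hle
    simp [Fin.sum_univ_succ] at hsum
    simp [funext_iff, Fin.forall_fin_succ]
    omega

/-- Here `m = u^(t+2) a^(t+1) b c`. Once triangles are excluded, every edge among the four vertices
contains `u`, so a generator dividing `m` has exponent `t + 2` at `u` and omits one factor of
`a^(t+1) b c`: three possibilities, with pairwise least common multiple `m`. -/
theorem not_isScarf_of_claw {u a b c : V} (ha : G.Adj u a) (hb : G.Adj u b) (hc : G.Adj u c)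
    (hab : a ≠ b) (hac : a ≠ c) (hbc : b ≠ c) (t : ℕ) :
    ¬ IsScarf (edgeIdeal k G ^ (t + 2)) := by
  by_cases nab : G.Adj a b
  · exact not_isScarf_of_triangle ha nab hb (t + 1)
  by_cases nac : G.Adj a c
  · exact not_isScarf_of_triangle ha nac hc (t + 1)
  by_cases nbc : G.Adj b c
  · exact not_isScarf_of_triangle hb nbc hc (t + 1)
  let f : Fin 4 ↪ V := ⟨![u, a, b, c], by
    intro i j
    fin_cases i <;> fin_cases j <;>
      simp [ha.ne, hb.ne, hc.ne, ha.ne', hb.ne', hc.ne', hab, hac, hbc, hab.symm, hac.symm, hbc.symm]⟩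
  have h0 : monomialOn f ![t + 2, t + 1, 1, 0] ∈ edgeSums G (t + 2) := by
    convert monomialOn_add_mem_edgeSums (f := f) (i := 0) (j := 2) hb
      (monomialOn_nsmul_mem_edgeSums (f := f) (i := 0) (j := 1) ha (t + 1)) using 2
    ext i; fin_cases i <;> simp +arith
  have h1 : monomialOn f ![t + 2, t + 1, 0, 1] ∈ edgeSums G (t + 2) := by
    convert monomialOn_add_mem_edgeSums (f := f) (i := 0) (j := 3) hc
      (monomialOn_nsmul_mem_edgeSums (f := f) (i := 0) (j := 1) ha (t + 1)) using 2
    ext i; fin_cases i <;> simp +arith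
  have h2 : monomialOn f ![t + 2, t, 1, 1] ∈ edgeSums G (t + 2) := by
    convert monomialOn_add_mem_edgeSums (f := f) (i := 0) (j := 2) hb
      (monomialOn_add_mem_edgeSums (f := f) (i := 0) (j := 3) hc
      (monomialOn_nsmul_mem_edgeSums (f := f) (i := 0) (j := 1) ha t)) using 2
    ext i; fin_cases i <;> simp +arith
  rw [← gens_edgeIdeal_pow (k := k)] at h0 h1 h2
  refine not_isScarf_of_isolated (span_gens_edgeIdeal_pow _) h0 h1 h2 ?_ ?_ ?_ ?_ ?_ ?_
  · simp [monomialOn_injective.eq_iff]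
  · simp [monomialOn_injective.eq_iff]
  · simp [monomialOn_injective.eq_iff]
  · simp [← monomialOn_sup, monomialOn_le_iff, Pi.le_def, Fin.forall_fin_succ]
  · simp [← monomialOn_sup, monomialOn_le_iff, Pi.le_def, Fin.forall_fin_succ]
  · intro s hs hle
    rw [← monomialOn_sup] at hle
    obtain ⟨x, rfl⟩ : ∃ x, s = monomialOn f x := ⟨_, eq_monomialOn_of_le hle⟩
    rw [gens_edgeIdeal_pow] at hs
    have hsum := sum_eq_of_mem_edgeSums hs
    have hw := sum_mul_eq_of_mem_edgeSums (c := ![1, 0, 0, 0]) (d := 1) (by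
      intro i j
      change G.Adj (![u, a, b, c] i) (![u, a, b, c] j) → _
      fin_cases i <;> fin_cases j <;>
        simp [nab, nac, nbc, G.adj_comm b a, G.adj_comm c a, G.adj_comm c b]) hs
    rw [monomialOn_le_iff] at hle
    simp only [monomialOn_injective.eq_iff]
    simp [Pi.le_def, Fin.forall_fin_succ] at hle
    simp [Fin.sum_univ_succ] at hsum hw
    simp [funext_iff, Fin.forall_fin_succ]
    omega

/-- The exponents of the generators of the power `t + 2` of the edge ideal of a path `a b c d`
that divide `a * b ^ (t + 2) * c ^ (t + 2) * d`. -/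
def squareExponents (t : ℕ) : Fin 4 → Fin 4 → ℕ :=
  ![![1, t + 2, t + 1, 0], ![0, t + 2, t + 2, 0], ![0, t + 1, t + 2, 1], ![1, t + 1, t + 1, 1]]

theorem squareExponents_le_sup_succ (t : ℕ) (i l : Fin 4)
    (h : squareExponents t l ≤ squareExponents t i ⊔ squareExponents t (i + 1)) :
    l = i ∨ l = i + 1 := by
  revert h
  fin_cases i <;> fin_cases l <;>
    simp [squareExponents, Pi.le_def, Fin.forall_fin_succ]

theorem squareExponents_diagonal (t : ℕ) (l : Fin 4) (h0 : l ≠ 0) (h1 : l ≠ 1) :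
    ∃ p, p ≠ l ∧ (p ≠ 0 ∧ squareExponents t p ≤ squareExponents t 0 ⊔ squareExponents t l ∨
      p ≠ 1 ∧ squareExponents t p ≤ squareExponents t 1 ⊔ squareExponents t l) := by
  fin_cases l
  · simp at h0
  · simp at h1
  · refine ⟨1, by simp, Or.inl ?_⟩
    simp [squareExponents, Pi.le_def, Fin.forall_fin_succ]
  · refine ⟨0, by simp, Or.inr ?_⟩
    simp [squareExponents, Pi.le_def, Fin.forall_fin_succ]

theorem not_isScarf_of_path {a b c d : V} (hab : G.Adj a b) (hbc : G.Adj b c) (hcd : G.Adj c d)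
    (hac : a ≠ c) (had : a ≠ d) (hbd : b ≠ d) (t : ℕ) :
    ¬ IsScarf (edgeIdeal k G ^ (t + 2)) := by
  by_cases nac : G.Adj a c
  · exact not_isScarf_of_triangle hab hbc nac (t + 1)
  by_cases nbd : G.Adj b d
  · exact not_isScarf_of_triangle hbc hcd nbd (t + 1)
  let f : Fin 4 ↪ V := ⟨![a, b, c, d], by
    intro i j
    fin_cases i <;> fin_cases j <;>
      simp [hab.ne, hbc.ne, hcd.ne, hab.ne', hbc.ne', hcd.ne', hac, had, hbd, hac.symm, had.symm,
        hbd.symm]⟩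
  have h0 : monomialOn f ![1, t + 2, t + 1, 0] ∈ edgeSums G (t + 2) := by
    convert monomialOn_add_mem_edgeSums (f := f) (i := 0) (j := 1) hab
      (monomialOn_nsmul_mem_edgeSums (f := f) (i := 1) (j := 2) hbc (t + 1)) using 2
    ext i; fin_cases i <;> simp +arith
  have h1 : monomialOn f ![0, t + 2, t + 2, 0] ∈ edgeSums G (t + 2) := by
    convert monomialOn_nsmul_mem_edgeSums (f := f) (i := 1) (j := 2) hbc (t + 2) using 2
    ext i; fin_cases i <;> simp
  have h2 : monomialOn f ![0, t + 1, t + 2, 1] ∈ edgeSums G (t + 2) := by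
    convert monomialOn_add_mem_edgeSums (f := f) (i := 2) (j := 3) hcd
      (monomialOn_nsmul_mem_edgeSums (f := f) (i := 1) (j := 2) hbc (t + 1)) using 2
    ext i; fin_cases i <;> simp +arith
  have h3 : monomialOn f ![1, t + 1, t + 1, 1] ∈ edgeSums G (t + 2) := by
    convert monomialOn_add_mem_edgeSums (f := f) (i := 0) (j := 1) hab
      (monomialOn_add_mem_edgeSums (f := f) (i := 2) (j := 3) hcd
      (monomialOn_nsmul_mem_edgeSums (f := f) (i := 1) (j := 2) hbc t)) using 2
    ext i; fin_cases i <;> simp +arith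
  rw [← gens_edgeIdeal_pow (k := k)] at h0 h1 h2 h3
  refine not_isScarf_of_hole (r := 1) (span_gens_edgeIdeal_pow _) (fun i => monomialOn f (squareExponents t i))
    (monomialOn f ![1, t + 2, t + 2, 1]) ?_ ?_ ?_ ?_ ?_ ?_
  · refine monomialOn_injective.comp ?_
    intro i j
    fin_cases i <;> fin_cases j <;> simp [squareExponents]
  · intro i
    fin_cases i
    exacts [h0, h1, h2, h3]
  · intro i
    simp only [monomialOn_le_iff]
    fin_cases i <;> simp [squareExponents, Pi.le_def, Fin.forall_fin_succ]
  · intro s hs hle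
    obtain ⟨x, rfl⟩ : ∃ x, s = monomialOn f x := ⟨_, eq_monomialOn_of_le hle⟩
    rw [gens_edgeIdeal_pow] at hs
    have hsum := sum_eq_of_mem_edgeSums hs
    -- Each edge has exactly one end in `{a, c}`, even if `a` and `d` are adjacent. So the exponents
    -- at `a` and `c` sum to `t + 2`, as do those at `b` and `d`, and only the four listed monomials
    -- remain.
    have hw := sum_mul_eq_of_mem_edgeSums (c := ![1, 0, 1, 0]) (d := 1) (by
      intro i j
      change G.Adj (![a, b, c, d] i) (![a, b, c, d] j) → _
      fin_cases i <;> fin_cases j <;>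
        simp [nac, nbd, G.adj_comm c a, G.adj_comm d b]) hs
    rw [monomialOn_le_iff] at hle
    simp only [monomialOn_injective.eq_iff]
    simp [Pi.le_def, Fin.forall_fin_succ] at hle
    simp [Fin.sum_univ_succ] at hsum hw
    simp [funext_iff, Fin.forall_fin_succ, Fin.exists_fin_succ, squareExponents]
    omega
  · simpa only [← monomialOn_sup, monomialOn_le_iff] using squareExponents_le_sup_succ t
  · simpa only [← monomialOn_sup, monomialOn_le_iff] using squareExponents_diagonal t

end ScarfIdeal
end

noncomputable section
namespace ScarfIdeal
variable {V : Type*} {k : Type*} [Field k] {G : SimpleGraph V}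

/-! ### Forbidden subgraphs for the first power -/

theorem ite_le_ite_sup_ite_iff {p q r : Prop} [Decidable p] [Decidable q] [Decidable r] :
    (if p then 1 else 0 : ℕ) ≤ (if q then 1 else 0) ⊔ (if r then 1 else 0) ↔ (p → q ∨ r) := by
  by_cases hp : p <;> by_cases hq : q <;> by_cases hr : r <;> simp [hp, hq, hr]

/-- If the edges `E l` between some vertices `f i` form a cycle in the Scarf complex of the edge
ideal, one of whose edges lies in no triangle, then the edge ideal is not Scarf. -/
theorem not_isScarf_edgeIdeal_of_hole {n r : ℕ} {f : Fin n → V} (hf : Function.Injective f)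
    (E : Fin (r + 3) → Fin n × Fin n) (hE : ∀ l, G.Adj (f (E l).1) (f (E l).2))
    (hEA : ∀ i j, G.Adj (f i) (f j) → ∃ l, E l = (i, j) ∨ E l = (j, i))
    (C : Fin (r + 3) → Fin (r + 3) → Fin (r + 3) → Prop)
    (hC : ∀ l i j, C l i j ↔ ∀ q, q = (E l).1 ∨ q = (E l).2 →
      (q = (E i).1 ∨ q = (E i).2) ∨ (q = (E j).1 ∨ q = (E j).2))
    (hinj : ∀ i l, C l i i → l = i)
    (hcon : ∀ i l, C l i (i + 1) → l = i ∨ l = i + 1)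
    (hnon : ∀ l, l ≠ 0 → l ≠ 1 → ∃ p, p ≠ l ∧ (p ≠ 0 ∧ C p 0 l ∨ p ≠ 1 ∧ C p 1 l)) :
    ¬ IsScarf (edgeIdeal k G) := by
  let f' : Fin n ↪ V := ⟨f, hf⟩
  let x (l : Fin (r + 3)) : Fin n → ℕ := Pi.single (E l).1 1 + Pi.single (E l).2 1
  have hx (l) : monomialOn f' (x l) =
      Finsupp.single (f (E l).1) 1 + Finsupp.single (f (E l).2) 1 := by
    rw [monomialOn_add, ← single_eq_monomialOn, ← single_eq_monomialOn]; rfl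
  have hx' (l i) : x l i = if i = (E l).1 ∨ i = (E l).2 then 1 else 0 := by
    have hne : (E l).1 ≠ (E l).2 := fun h => (hE l).ne (congrArg f h)
    simp only [x, Pi.add_apply, Pi.single_apply]
    by_cases h1 : i = (E l).1
    · have h2 : i ≠ (E l).2 := fun h => hne (h1.symm.trans h)
      simp [h1, hne]
    · simp [h1]
  -- For squarefree monomials divisibility is containment of the sets of ends, so the hypotheses on
  -- `C` are finite combinatorics about `E`, settled by `decide` in each application.
  have hle (l i j) : monomialOn f' (x l) ≤ monomialOn f' (x i) ⊔ monomialOn f' (x j) ↔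
      C l i j := by
    rw [← monomialOn_sup, monomialOn_le_iff, hC]
    refine forall_congr' fun q => ?_
    rw [Pi.sup_apply, hx', hx', hx']
    exact ite_le_ite_sup_ite_iff
  rw [← pow_one (edgeIdeal k G)]
  refine not_isScarf_of_hole (span_gens_edgeIdeal_pow _) (fun i => monomialOn f' (x i))
    (monomialOn f' 1) ?_ ?_ ?_ ?_ (fun i l => (hcon i l) ∘ (hle l i (i + 1)).1)
    (by simpa only [hle] using hnon)
  · intro l i h
    exact hinj i l ((hle l i i).1 (h.le.trans le_sup_left))
  · intro l
    rw [gens_edgeIdeal_pow, mem_edgeSums_one]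
    exact ⟨_, _, hE l, hx l⟩
  · intro l
    rw [monomialOn_le_iff]
    intro i
    rw [hx']
    exact (ite_le_sup _ _ _).trans (by simp)
  · intro s hs hle
    rw [gens_edgeIdeal_pow, mem_edgeSums_one] at hs
    obtain ⟨u, v, huv, rfl⟩ := hs
    have mem (w : V) (hw : (Finsupp.single w 1 : V →₀ ℕ) ≤ monomialOn f' 1) :
        w ∈ Set.range f := by
      by_contra hwf
      have := hw w
      rw [monomialOn, Finsupp.embDomain_of_notMem_range _ _ _ hwf] at this
      simp at this
    obtain ⟨i, rfl⟩ := mem u ((le_add_right le_rfl).trans hle)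
    obtain ⟨j, rfl⟩ := mem v (le_add_self.trans hle)
    obtain ⟨l, h | h⟩ := hEA i j huv
    · exact ⟨l, by rw [hx, h]⟩
    · exact ⟨l, by rw [hx, h, add_comm]⟩

theorem not_isScarf_edgeIdeal_of_triangle {a b c : V} (hab : G.Adj a b) (hbc : G.Adj b c)
    (hac : G.Adj a c) : ¬ IsScarf (edgeIdeal k G) := by
  simpa using not_isScarf_of_triangle (k := k) hab hbc hac 0

theorem not_isScarf_edgeIdeal_of_four_cycle {a b c d : V} (hab : G.Adj a b) (hbc : G.Adj b c)
    (hcd : G.Adj c d) (hda : G.Adj d a) (hac : a ≠ c) (hbd : b ≠ d) :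
    ¬ IsScarf (edgeIdeal k G) := by
  by_cases nac : G.Adj a c
  · exact not_isScarf_edgeIdeal_of_triangle hab hbc nac
  by_cases nbd : G.Adj b d
  · exact not_isScarf_edgeIdeal_of_triangle hbc hcd nbd
  refine not_isScarf_edgeIdeal_of_hole (r := 1) (f := ![a, b, c, d]) ?_
    ![(0, 1), (1, 2), (2, 3), (3, 0)] ?_ ?_ _ (fun _ _ _ => Iff.rfl) (by decide) (by decide)
    (by decide)
  · intro i j
    fin_cases i <;> fin_cases j <;>
      simp [hab.ne, hbc.ne, hcd.ne, hab.ne', hbc.ne', hcd.ne', hac, hda.ne, hda.ne', hbd, hac.symm,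
        hbd.symm]
  · simp [Fin.forall_fin_succ, hab, hbc, hcd, hda]
  · intro i j
    fin_cases i <;> fin_cases j <;> simp [Fin.exists_fin_succ, nac, nbd, G.adj_comm c a, G.adj_comm d b]

theorem not_isScarf_edgeIdeal_of_five_cycle {a b c d e : V} (hab : G.Adj a b) (hbc : G.Adj b c)
    (hcd : G.Adj c d) (hde : G.Adj d e) (hea : G.Adj e a) (hac : a ≠ c) (had : a ≠ d)
    (hbd : b ≠ d) (hbe : b ≠ e) (hce : c ≠ e) :
    ¬ IsScarf (edgeIdeal k G) := by
  by_cases nac : G.Adj a c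
  · exact not_isScarf_edgeIdeal_of_triangle hab hbc nac
  by_cases nbd : G.Adj b d
  · exact not_isScarf_edgeIdeal_of_triangle hbc hcd nbd
  by_cases nce : G.Adj c e
  · exact not_isScarf_edgeIdeal_of_triangle hcd hde nce
  by_cases nad : G.Adj a d
  · exact not_isScarf_edgeIdeal_of_triangle hde hea nad.symm
  by_cases nbe : G.Adj b e
  · exact not_isScarf_edgeIdeal_of_triangle hea hab nbe.symm
  refine not_isScarf_edgeIdeal_of_hole (r := 2) (f := ![a, b, c, d, e]) ?_
    ![(0, 1), (1, 2), (2, 3), (3, 4), (4, 0)] ?_ ?_ _ (fun _ _ _ => Iff.rfl) (by decide)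
    (by decide) (by decide)
  · intro i j
    fin_cases i <;> fin_cases j <;>
      simp [hab.ne, hbc.ne, hcd.ne, hde.ne, hea.ne, hab.ne', hbc.ne', hcd.ne', hde.ne', hea.ne',
        hac, had, hbd, hbe, hce, hac.symm, had.symm, hbd.symm, hbe.symm, hce.symm]
  · simp [Fin.forall_fin_succ, hab, hbc, hcd, hde, hea]
  · intro i j
    fin_cases i <;> fin_cases j <;> simp [Fin.exists_fin_succ, nac, nad, nbd, nbe, nce,
      G.adj_comm c a, G.adj_comm d b, G.adj_comm d a, G.adj_comm e b, G.adj_comm e c]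

/-- The four edges form a square in the Scarf complex: `ab` and `de` are also joined there, since no
edge of `G` connects them. The diagonals are missing, because `bc` divides the label of `{ab, cd}`
and `cd` that of `{bc, de}`. -/
theorem not_isScarf_edgeIdeal_of_induced_path {a b c d e : V} (hab : G.Adj a b) (hbc : G.Adj b c)
    (hcd : G.Adj c d) (hde : G.Adj d e) (hac : a ≠ c) (had : a ≠ d) (hae : a ≠ e)
    (hbd : b ≠ d) (hbe : b ≠ e) (hce : c ≠ e) (nac : ¬ G.Adj a c) (nad : ¬ G.Adj a d)
    (nae : ¬ G.Adj a e) (nbd : ¬ G.Adj b d) (nbe : ¬ G.Adj b e) (nce : ¬ G.Adj c e) :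
    ¬ IsScarf (edgeIdeal k G) := by
  refine not_isScarf_edgeIdeal_of_hole (r := 1) (f := ![a, b, c, d, e]) ?_
    ![(0, 1), (1, 2), (2, 3), (3, 4)] ?_ ?_ _ (fun _ _ _ => Iff.rfl) (by decide)
    (by decide) (by decide)
  · intro i j
    fin_cases i <;> fin_cases j <;>
      simp [hab.ne, hbc.ne, hcd.ne, hde.ne, hab.ne', hbc.ne', hcd.ne', hde.ne', hae, hae.symm,
        hac, had, hbd, hbe, hce, hac.symm, had.symm, hbd.symm, hbe.symm, hce.symm]
  · simp [Fin.forall_fin_succ, hab, hbc, hcd, hde]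
  · intro i j
    fin_cases i <;> fin_cases j <;> simp [Fin.exists_fin_succ, nac, nad, nae, nbd, nbe, nce,
      G.adj_comm c a, G.adj_comm d b, G.adj_comm d a, G.adj_comm e b, G.adj_comm e c,
      G.adj_comm e a]

end ScarfIdeal
end

noncomputable section
namespace ScarfIdeal
variable {V : Type*} {G : SimpleGraph V}

/-! ### Gap-free forests -/

/-- A triangle-free graph without induced paths on five vertices is gap-free. -/
theorem gapFree_of_forall_not_induced_path
    (h3 : ∀ a b c, G.Adj a b → G.Adj b c → ¬ G.Adj a c)
    (h5 : ∀ a b c d e, G.Adj a b → G.Adj b c → G.Adj c d → G.Adj d e → a ≠ c → a ≠ d → a ≠ e →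
      b ≠ d → b ≠ e → c ≠ e → ¬ G.Adj a c → ¬ G.Adj a d → ¬ G.Adj a e → ¬ G.Adj b d →
      ¬ G.Adj b e → G.Adj c e) : GapFree G := by
  intro x₁ x₂ y₁ y₂ hx hy hr
  -- Invariant along a walk from `x₁`: either `y` or every neighbour of `y` is adjacent to an end of
  -- `x₁x₂`. A first failure produces an induced five-vertex path, namely `p q y y' z` in `aux`.
  have key : ∀ y, Relation.ReflTransGen G.Adj x₁ y →
      (G.Adj x₁ y ∨ G.Adj x₂ y) ∨ ∀ z, G.Adj y z → G.Adj x₁ z ∨ G.Adj x₂ z := by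
    intro y h
    induction h with
    | refl => exact Or.inl (Or.inr hx.symm)
    | @tail y y' _ hyy' ih =>
      by_contra! H
      obtain ⟨⟨n1, n2⟩, z, hz, m1, m2⟩ := H
      have aux : ∀ p q, G.Adj p q → G.Adj q y → ¬ G.Adj p y' → ¬ G.Adj q y' → ¬ G.Adj p z →
          ¬ G.Adj q z → False := by
        intro p q hpq hqy np nq mp mq
        have npy : ¬ G.Adj p y := h3 p q y hpq hqy
        have nyz : ¬ G.Adj y z := h3 y y' z hyy' hz
        refine nyz (h5 p q y y' z hpq hqy hyy' hz ?_ ?_ ?_ ?_ ?_ ?_ npy np mp nq mq)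
        · rintro rfl; exact np hyy'
        · rintro rfl; exact nq hpq.symm
        · rintro rfl; exact mq hpq.symm
        · rintro rfl; exact np hpq
        · rintro rfl; exact mp hpq
        · rintro rfl; exact mq hqy
      rcases ih with (h | h) | h
      · exact aux x₂ x₁ hx.symm h n2 n1 m2 m1
      · exact aux x₁ x₂ hx h n1 n2 m1 m2
      · exact (h y' hyy').elim n1 n2
  rcases key y₁ ((G.reachable_iff_reflTransGen _ _).1 hr) with (h | h) | h
  · exact Or.inl h
  · exact Or.inr (Or.inr (Or.inl h))
  · rcases h y₂ hy with h | h
    · exact Or.inr (Or.inl h)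
    · exact Or.inr (Or.inr (Or.inr h))

/-- A gap-free graph without cycles of length at most five has no cycles. -/
theorem isAcyclic_of_gapFree (hG : GapFree G)
    (h3 : ∀ a b c, G.Adj a b → G.Adj b c → ¬ G.Adj a c)
    (h4 : ∀ a b c d, G.Adj a b → G.Adj b c → G.Adj c d → a ≠ c → b ≠ d → ¬ G.Adj d a)
    (h5 : ∀ a b c d e, G.Adj a b → G.Adj b c → G.Adj c d → G.Adj d e → a ≠ c → a ≠ d → b ≠ d →
      b ≠ e → c ≠ e → ¬ G.Adj e a) : G.IsAcyclic := by
  intro v p hp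
  have hlen := hp.three_le_length
  have adj (i : ℕ) (hi : i < p.length) := p.adj_getVert_succ hi
  have ne1 (i j : ℕ) (hij : i < j) (hj : j < p.length) : p.getVert i ≠ p.getVert j := fun h => by
    have := hp.getVert_injOn' (show i ≤ p.length - 1 by omega) (show j ≤ p.length - 1 by omega) h
    omega
  have ne2 (i j : ℕ) (hi : 1 ≤ i) (hij : i < j) (hj : j ≤ p.length) :
      p.getVert i ≠ p.getVert j := fun h => by
    have := hp.getVert_injOn (show 1 ≤ i ∧ i ≤ p.length by omega)
      (show 1 ≤ j ∧ j ≤ p.length by omega) h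
    omega
  have a01 := adj 0 (by omega)
  have a12 := adj 1 (by omega)
  have a23 := adj 2 (by omega)
  norm_num at a01 a12 a23
  rcases Nat.lt_or_ge 3 p.length with hl | hl
  · have a34 := adj 3 hl
    norm_num at a34
    have n02 := ne1 0 2 (by omega) (by omega)
    have n03 := ne1 0 3 (by omega) (by omega)
    have n13 := ne1 1 3 (by omega) (by omega)
    have n14 := ne2 1 4 (by omega) (by omega) (by omega)
    have n24 := ne2 2 4 (by omega) (by omega) (by omega)
    rw [SimpleGraph.Walk.getVert_zero] at n02 n03
    -- An edge joining the first and the fourth edge of the cycle closes a cycle of length 3, 4 or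
    -- 5. If the cycle has length four, vertex 4 is the base point again; the four cases remain
    -- valid, since distinctness of vertices 0 and 4 is never required.
    rcases hG _ _ _ _ a01 a34 ((a01.reachable.trans a12.reachable).trans a23.reachable) with
      h | h | h | h
    · exact h4 _ _ _ _ a01 a12 a23 n02 n13 h.symm
    · exact h5 _ _ _ _ _ a01 a12 a23 a34 n02 n03 n13 n14 n24 h.symm
    · exact h3 _ _ _ a12 a23 h
    · exact h4 _ _ _ _ a12 a23 a34 n13 n24 h.symm
  · have h30 : p.getVert 3 = v := by
      have : p.length = 3 := le_antisymm hl hlen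
      rw [← this, p.getVert_length]
    rw [h30] at a23
    exact h3 _ _ _ a01 a12 a23.symm

/-- In a forest, an edge `u v` separates `u` from `v`. -/
theorem exists_separation (hG : G.IsAcyclic) {u v : V} (h : G.Adj u v) :
    ∃ R : V → V → Prop, Equivalence R ∧ ¬ R u v ∧
      ∀ a b, G.Adj a b → ¬ (a = u ∧ b = v) → ¬ (a = v ∧ b = u) → R a b := by
  refine ⟨(G.deleteEdges {s(u, v)}).Reachable, SimpleGraph.reachable_is_equivalence _,
    SimpleGraph.isBridge_iff.1 (SimpleGraph.isAcyclic_iff_forall_adj_isBridge.1 hG h), ?_⟩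
  intro a b hab h1 h2
  refine SimpleGraph.Adj.reachable ?_
  rw [SimpleGraph.deleteEdges_adj]
  refine ⟨hab, ?_⟩
  rw [Set.mem_singleton_iff, Sym2.eq_iff]
  tauto

/-- The walk `a b c` avoids the edge `ac`, which would separate its ends. -/
theorem not_adj_of_isAcyclic (hG : G.IsAcyclic) {a b c : V} (hab : G.Adj a b) (hbc : G.Adj b c) :
    ¬ G.Adj a c := by
  intro hac
  obtain ⟨R, hR, hn, h⟩ := exists_separation hG hac
  refine hn (hR.trans (h a b hab ?_ ?_) (h b c hbc ?_ ?_))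
  · exact fun h => hbc.ne h.2
  · exact fun h => hac.ne h.1
  · exact fun h => hab.ne h.1.symm
  · exact fun h => hbc.ne h.1

/-- Among the edges of a component of a gap-free forest that lie in a given set of vertices, one
meets all the others. -/
theorem exists_edge_meeting_all (hG : G.IsAcyclic) (hgap : GapFree G) (W : V → Prop) {x₁ x₂ : V}
    (hx : G.Adj x₁ x₂) (hW₁ : W x₁) (hW₂ : W x₂) :
    ∃ x y, G.Adj x y ∧ W x ∧ W y ∧ G.Reachable x₁ x ∧
      ∀ z₁ z₂, G.Adj z₁ z₂ → W z₁ → W z₂ → G.Reachable x₁ z₁ →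
        z₁ = x ∨ z₁ = y ∨ z₂ = x ∨ z₂ = y := by
  by_cases H : ∀ z₁ z₂, G.Adj z₁ z₂ → W z₁ → W z₂ → G.Reachable x₁ z₁ →
      z₁ = x₁ ∨ z₁ = x₂ ∨ z₂ = x₁ ∨ z₂ = x₂
  · exact ⟨x₁, x₂, hx, hW₁, hW₂, SimpleGraph.Reachable.refl _, H⟩
  push Not at H
  obtain ⟨y₁, y₂, hy, hY₁, hY₂, hr, n11, n12, n21, n22⟩ := H
  -- An edge `ab` joining the disjoint edges `aa'` and `bb'` meets all the others: an edge `z₁z₂`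
  -- missing it would be linked, by gap-freeness, to both `aa'` and `bb'`, hence to both sides of
  -- `ab` without using `ab`.
  have aux : ∀ a a' b b', G.Adj a a' → G.Adj b b' → W a → W b → G.Reachable x₁ a →
      G.Reachable x₁ b → b ≠ a' → b' ≠ a → G.Adj a b → ∃ x y, G.Adj x y ∧ W x ∧ W y ∧
        G.Reachable x₁ x ∧ ∀ z₁ z₂, G.Adj z₁ z₂ → W z₁ → W z₂ → G.Reachable x₁ z₁ →
        z₁ = x ∨ z₁ = y ∨ z₂ = x ∨ z₂ = y := by
    intro a a' b b' ha hb hWa hWb hra hrb nb nb' hab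
    refine ⟨a, b, hab, hWa, hWb, hra, fun z₁ z₂ hz _ _ hrz => ?_⟩
    by_contra! hn
    obtain ⟨n1a, n1b, n2a, n2b⟩ := hn
    obtain ⟨R, hR, hRn, hRa⟩ := exists_separation hG hab
    have hz12 : R z₁ z₂ := hRa _ _ hz (fun h => n1a h.1) (fun h => n1b h.1)
    have haa' : R a a' := hRa _ _ ha (fun h => nb h.2.symm) (fun h => hab.ne h.1)
    have hbb' : R b b' := hRa _ _ hb (fun h => hab.ne h.1.symm) (fun h => nb' h.2)
    have hz1 (w : V) (h : G.Adj z₁ w) : R z₁ w := hRa _ _ h (fun h => n1a h.1) (fun h => n1b h.1)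
    have hz2 (w : V) (h : G.Adj z₂ w) : R z₁ w :=
      hR.trans hz12 (hRa _ _ h (fun h => n2a h.1) (fun h => n2b h.1))
    have hza : R z₁ a := by
      rcases hgap z₁ z₂ a a' hz ha (hrz.symm.trans hra) with h | h | h | h
      · exact hz1 _ h
      · exact hR.trans (hz1 _ h) (hR.symm haa')
      · exact hz2 _ h
      · exact hR.trans (hz2 _ h) (hR.symm haa')
    have hzb : R z₁ b := by
      rcases hgap z₁ z₂ b b' hz hb (hrz.symm.trans hrb) with h | h | h | h
      · exact hz1 _ h
      · exact hR.trans (hz1 _ h) (hR.symm hbb')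
      · exact hz2 _ h
      · exact hR.trans (hz2 _ h) (hR.symm hbb')
    exact hRn (hR.trans (hR.symm hza) hzb)
  rcases hgap x₁ x₂ y₁ y₂ hx hy hr with h | h | h | h
  · exact aux x₁ x₂ y₁ y₂ hx hy hW₁ hY₁ (SimpleGraph.Reachable.refl _) hr n12 n21 h
  · exact aux x₁ x₂ y₂ y₁ hx hy.symm hW₁ hY₂ (SimpleGraph.Reachable.refl _)
      (hr.trans hy.reachable) n22 n11 h
  · exact aux x₂ x₁ y₁ y₂ hx.symm hy hW₂ hY₁ hx.reachable hr n11 n22 h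
  · exact aux x₂ x₁ y₂ y₁ hx.symm hy.symm hW₂ hY₂ hx.reachable (hr.trans hy.reachable) n21 n12 h

/-! ### Graphs without triangles, claws and paths on four vertices -/

theorem nonempty_iso_pathGraph {n : ℕ} (f : Fin n → V) (hf : Function.Bijective f)
    (h : ∀ i j, G.Adj (f i) (f j) ↔ (i : ℕ) + 1 = j ∨ (j : ℕ) + 1 = i) :
    Nonempty (G ≃g SimpleGraph.pathGraph n) := by
  let e := Equiv.ofBijective f hf
  refine ⟨(⟨e, ?_⟩ : SimpleGraph.pathGraph n ≃g G).symm⟩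
  intro i j
  rw [SimpleGraph.pathGraph_adj]
  exact h i j

theorem mem_of_connected (hG : G.Connected) {S : Set V} {u : V} (hu : u ∈ S)
    (h : ∀ a ∈ S, ∀ b, G.Adj a b → b ∈ S) (v : V) : v ∈ S := by
  have := (G.reachable_iff_reflTransGen u v).1 (hG.preconnected u v)
  induction this with
  | refl => exact hu
  | tail _ hab ih => exact h _ ih _ hab

/-- If some vertex has two neighbours, the three vertices are closed under adjacency, as a further
neighbour would create a claw or a four-vertex path. Otherwise every vertex has at most one
neighbour. -/
theorem nonempty_iso_pathGraph_of_connected (hG : G.Connected)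
    (h3 : ∀ a b c, G.Adj a b → G.Adj b c → ¬ G.Adj a c)
    (hclaw : ∀ u a b c, G.Adj u a → G.Adj u b → G.Adj u c → a ≠ b → a ≠ c → b = c)
    (hpath : ∀ a b c d, G.Adj a b → G.Adj b c → G.Adj c d → a ≠ c → a ≠ d → b = d) :
    Nonempty (G ≃g SimpleGraph.pathGraph 1) ∨ Nonempty (G ≃g SimpleGraph.pathGraph 2) ∨
      Nonempty (G ≃g SimpleGraph.pathGraph 3) := by
  by_cases H : ∃ u a b, G.Adj u a ∧ G.Adj u b ∧ a ≠ b
  · obtain ⟨u, a, b, ha, hb, hab⟩ := H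
    refine Or.inr (Or.inr (nonempty_iso_pathGraph ![a, u, b] ⟨?_, ?_⟩ ?_))
    · intro i j
      fin_cases i <;> fin_cases j <;> simp [ha.ne, ha.ne', hb.ne, hb.ne', hab, hab.symm]
    · intro v
      have hv : v ∈ ({a, u, b} : Set V) := by
        refine mem_of_connected hG (u := u) (by simp) ?_ v
        simp only [Set.mem_insert_iff, Set.mem_singleton_iff]
        rintro x (rfl | rfl | rfl) y hxy
        · by_contra! hn
          exact hn.2.1 (hpath b u x y hb.symm ha hxy hab.symm hn.2.2.symm).symm
        · by_contra! hn
          exact hn.2.2 (hclaw x a b y ha hb hxy hab hn.1.symm).symm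
        · by_contra! hn
          exact hn.2.1 (hpath a u x y ha.symm hb hxy hab hn.1.symm).symm
      rcases hv with rfl | rfl | rfl
      · exact ⟨0, rfl⟩
      · exact ⟨1, rfl⟩
      · exact ⟨2, rfl⟩
    · have nab := h3 a u b ha.symm hb
      intro i j
      fin_cases i <;> fin_cases j <;> simp [ha, hb, ha.symm, hb.symm, nab, G.adj_comm b a]
  · push Not at H
    obtain ⟨u⟩ := hG.nonempty
    by_cases hu : ∃ a, G.Adj u a
    · obtain ⟨a, ha⟩ := hu
      refine Or.inr (Or.inl (nonempty_iso_pathGraph ![u, a] ⟨?_, ?_⟩ ?_))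
      · intro i j
        fin_cases i <;> fin_cases j <;> simp [ha.ne, ha.ne']
      · intro v
        have hv : v ∈ ({u, a} : Set V) := by
          refine mem_of_connected hG (u := u) (by simp) ?_ v
          simp only [Set.mem_insert_iff, Set.mem_singleton_iff]
          rintro x (rfl | rfl) y hxy
          · exact Or.inr (H _ _ _ hxy ha)
          · exact Or.inl (H _ _ _ hxy ha.symm)
        rcases hv with rfl | rfl
        · exact ⟨0, rfl⟩
        · exact ⟨1, rfl⟩
      · intro i j
        fin_cases i <;> fin_cases j <;> simp [ha, ha.symm]
    · push Not at hu
      refine Or.inl (nonempty_iso_pathGraph ![u] ⟨Function.injective_of_subsingleton _, ?_⟩ ?_)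
      · intro v
        have hv : v ∈ ({u} : Set V) := by
          refine mem_of_connected hG (u := u) (by simp) ?_ v
          rintro x rfl y hxy
          exact absurd hxy (hu y)
        exact ⟨0, hv.symm⟩
      · intro i j
        fin_cases i; fin_cases j; simp

end ScarfIdeal
end

noncomputable section
namespace ScarfIdeal
variable {V : Type*} {G : SimpleGraph V}
open scoped Classical
variable {k : Type*} [Field k]

/-! ### The Scarf resolution of the edge ideal of a gap-free forest -/

theorem isAcyclicComplex_of_subset_singleton_empty {K : Set (Finset (V →₀ ℕ))}
    (h : ∀ σ ∈ K, σ = ∅) : IsAcyclicComplex k K := by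
  intro n z hz _
  refine ⟨0, Submodule.zero_mem _, ?_⟩
  have : z = 0 := by
    ext σ
    by_contra hσ
    obtain ⟨h1, h2⟩ := mem_chains.1 hz σ hσ
    rw [h σ h1] at h2
    simp at h2
  rw [this, map_zero]

/-- The product of the variables at `u` and `v`. -/
def edgeMonomial (u v : V) : V →₀ ℕ := Finsupp.single u 1 + Finsupp.single v 1

theorem edgeMonomial_comm (u v : V) : edgeMonomial u v = edgeMonomial v u := add_comm _ _

theorem edgeMonomial_apply_ne_zero {u v w : V} : edgeMonomial u v w ≠ 0 ↔ w = u ∨ w = v := by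
  by_cases h1 : u = w <;> by_cases h2 : v = w <;>
    simp [edgeMonomial, h1, h2, eq_comm]

theorem edgeMonomial_le_iff {u v : V} (h : u ≠ v) {m : V →₀ ℕ} :
    edgeMonomial u v ≤ m ↔ m u ≠ 0 ∧ m v ≠ 0 := by
  constructor
  · intro hle
    have h1 := hle u
    have h2 := hle v
    have h3 := edgeMonomial_apply_ne_zero.2 (Or.inl rfl : u = u ∨ u = v)
    have h4 := edgeMonomial_apply_ne_zero.2 (Or.inr rfl : v = u ∨ v = v)
    omega
  · rintro ⟨h1, h2⟩ w
    by_cases hu : u = w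
    · subst hu
      simp [edgeMonomial, h.symm]
      omega
    · by_cases hv : v = w
      · subst hv
        simp [edgeMonomial, hu]
        omega
      · simp [edgeMonomial, hu, hv]

theorem label_insert (g : V →₀ ℕ) (σ : Finset (V →₀ ℕ)) : label (insert g σ) = g ⊔ label σ :=
  Finset.sup_insert

theorem label_apply_ne_zero {σ : Finset (V →₀ ℕ)} {u : V} :
    label σ u ≠ 0 ↔ ∃ g ∈ σ, g u ≠ 0 := by
  induction σ using Finset.induction_on with
  | empty =>
    have h : label (∅ : Finset (V →₀ ℕ)) = 0 := Finset.sup_empty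
    simp [h]
  | insert a s _ ih =>
    rw [label_insert, Finsupp.sup_apply, Finset.exists_mem_insert, ← ih, Nat.max_def]
    split_ifs <;> omega

theorem mem_gens_edgeIdeal {g : V →₀ ℕ} :
    g ∈ gens (edgeIdeal k G) ↔ ∃ u v, G.Adj u v ∧ g = edgeMonomial u v := by
  rw [← pow_one (edgeIdeal k G), gens_edgeIdeal_pow, mem_edgeSums_one]
  rfl

theorem exists_edgeMonomial_of_apply_ne_zero {g : V →₀ ℕ} (hg : g ∈ gens (edgeIdeal k G)) {u : V}
    (hu : g u ≠ 0) : ∃ v, G.Adj u v ∧ g = edgeMonomial u v := by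
  obtain ⟨a, b, hab, rfl⟩ := mem_gens_edgeIdeal.1 hg
  rcases edgeMonomial_apply_ne_zero.1 hu with rfl | rfl
  · exact ⟨b, hab, rfl⟩
  · exact ⟨a, hab.symm, edgeMonomial_comm _ _⟩

/-- Since `y` lies on no edge of `σ`, every edge of `σ` in the component of `x` contains `x`. A new
edge dividing the enlarged label would form a triangle with `xy`, so none appears. As for
irredundancy, `y` is private to `xy`, an edge `xp` of `σ` keeps `p` private, and edges missing `x`
keep the private vertex they had in `σ`. -/
theorem insert_mem_scarfComplex (hG : G.IsAcyclic) {x y : V} (hxy : G.Adj x y)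
    {σ : Finset (V →₀ ℕ)} (hσ : σ ∈ scarfComplex (edgeIdeal k G))
    (hmeet : ∀ z₁ z₂, G.Adj z₁ z₂ → edgeMonomial z₁ z₂ ∈ σ → G.Reachable x z₁ →
        z₁ = x ∨ z₁ = y ∨ z₂ = x ∨ z₂ = y)
    (hy : label σ y = 0) :
    insert (edgeMonomial x y) σ ∈ scarfComplex (edgeIdeal k G) := by
  obtain ⟨hne, hgens, hclosed, hpriv⟩ := mem_scarfComplex_iff.1 hσ
  have hy' : ∀ g ∈ σ, g y = 0 := fun g hg => by
    by_contra h
    exact label_apply_ne_zero.2 ⟨g, hg, h⟩ hy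
  have hwσ : edgeMonomial x y ∉ σ := fun h =>
    edgeMonomial_apply_ne_zero.2 (Or.inr rfl) (hy' _ h)
  -- an edge of the face at a vertex reachable from `x` contains `x`
  have hx {v v' : V} (h : G.Adj v v') (hm : edgeMonomial v v' ∈ σ) (hr : G.Reachable x v) :
      v = x ∨ v' = x := by
    have h0 := hy' _ hm
    rcases hmeet v v' h hm hr with h | h | h | h
    · exact Or.inl h
    · exact absurd h0 (edgeMonomial_apply_ne_zero.2 (Or.inl h.symm))
    · exact Or.inr h
    · exact absurd h0 (edgeMonomial_apply_ne_zero.2 (Or.inr h.symm))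
  have hlab (τ : Finset (V →₀ ℕ)) (v : V) : label (insert (edgeMonomial x y) τ) v ≠ 0 ↔
      (v = x ∨ v = y) ∨ label τ v ≠ 0 := by
    rw [label_apply_ne_zero, Finset.exists_mem_insert, edgeMonomial_apply_ne_zero,
      label_apply_ne_zero]
  refine mem_scarfComplex_iff.2 ⟨Finset.insert_nonempty _ _, ?_, ?_, ?_⟩
  · intro g hg
    rcases Finset.mem_insert.1 hg with rfl | hg
    · exact mem_gens_edgeIdeal.2 ⟨x, y, hxy, rfl⟩
    · exact hgens g hg
  · have aux (u v : V) (huv : G.Adj u v) (hu : u = x ∨ u = y) (hu' : label σ u = 0)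
        (hv : (v = x ∨ v = y) ∨ label σ v ≠ 0) :
        edgeMonomial u v ∈ insert (edgeMonomial x y) σ := by
      by_cases hvxy : v = x ∨ v = y
      · rw [Finset.mem_insert]
        left
        rcases hu with rfl | rfl <;> rcases hvxy with rfl | rfl
        · exact absurd rfl huv.ne
        · rfl
        · exact edgeMonomial_comm _ _
        · exact absurd rfl huv.ne
      · exfalso
        obtain ⟨g, hg, hgv⟩ := label_apply_ne_zero.1 (hv.resolve_left hvxy)
        obtain ⟨v', hvv', rfl⟩ := exists_edgeMonomial_of_apply_ne_zero (hgens g hg) hgv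
        have hr : G.Reachable x v := by
          rcases hu with rfl | rfl
          · exact huv.reachable
          · exact hxy.reachable.trans huv.reachable
        rcases hx hvv' hg hr with rfl | rfl
        · exact hvxy (Or.inl rfl)
        · have hxl : label σ v' ≠ 0 :=
            label_apply_ne_zero.2 ⟨_, hg, edgeMonomial_apply_ne_zero.2 (Or.inr rfl)⟩
          rcases hu with rfl | rfl
          · exact hxl hu'
          · exact not_adj_of_isAcyclic hG hxy huv hvv'.symm
    intro f hf hfl
    obtain ⟨u, v, huv, rfl⟩ := mem_gens_edgeIdeal.1 hf
    rw [edgeMonomial_le_iff huv.ne, hlab, hlab] at hfl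
    by_cases hu : label σ u = 0
    · exact aux u v huv (hfl.1.resolve_right (not_not.2 hu)) hu hfl.2
    · by_cases hv : label σ v = 0
      · rw [edgeMonomial_comm u v]
        exact aux v u huv.symm (hfl.2.resolve_right (not_not.2 hv)) hv hfl.1
      · exact Finset.mem_insert_of_mem
          (hclosed _ hf ((edgeMonomial_le_iff huv.ne).2 ⟨hu, hv⟩))
  · intro g hg hgne hle
    rcases Finset.mem_insert.1 hg with rfl | hgσ
    · rw [Finset.erase_insert hwσ, edgeMonomial_le_iff hxy.ne] at hle
      exact hle.2 hy
    · have hgw : edgeMonomial x y ≠ g := fun h => hwσ (h ▸ hgσ)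
      obtain ⟨u, v, huv, rfl⟩ := mem_gens_edgeIdeal.1 (hgens g hgσ)
      rw [Finset.erase_insert_of_ne hgw, edgeMonomial_le_iff huv.ne, hlab, hlab] at hle
      have huy : u ≠ y := fun h =>
        edgeMonomial_apply_ne_zero.2 (Or.inl h.symm) (hy' _ hgσ)
      have hvy : v ≠ y := fun h =>
        edgeMonomial_apply_ne_zero.2 (Or.inr h.symm) (hy' _ hgσ)
      have aux (p : V) (hpx : G.Adj x p) (hg : edgeMonomial u v = edgeMonomial x p)
          (hp : label (σ.erase (edgeMonomial u v)) p ≠ 0) : False := by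
        obtain ⟨g, hgm, hgp⟩ := label_apply_ne_zero.1 hp
        obtain ⟨q, hpq, rfl⟩ := exists_edgeMonomial_of_apply_ne_zero
          (hgens g (Finset.mem_of_mem_erase hgm)) hgp
        rcases hx hpq (Finset.mem_of_mem_erase hgm) hpx.reachable with rfl | rfl
        · exact hpx.ne rfl
        · exact (Finset.mem_erase.1 hgm).1 (by rw [hg, edgeMonomial_comm])
      by_cases hux : u = x
      · subst hux
        exact aux v huv rfl (hle.2.resolve_left (by rintro (h | h); exacts [huv.ne h.symm, hvy h]))
      · by_cases hvx : v = x
        · subst hvx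
          exact aux u huv.symm (edgeMonomial_comm _ _)
            (hle.1.resolve_left (by rintro (h | h); exacts [huv.ne h, huy h]))
        · have hl := (edgeMonomial_le_iff huv.ne).2 ⟨hle.1.resolve_left (by tauto),
            hle.2.resolve_left (by tauto)⟩
          obtain ⟨g, hg, -⟩ := label_apply_ne_zero.1 (hle.1.resolve_left (by tauto))
          exact hpriv _ hgσ ⟨g, hg⟩ hl

theorem isScarf_edgeIdeal_of_isAcyclic_of_gapFree (hG : G.IsAcyclic) (hgap : GapFree G) :
    IsScarf (edgeIdeal k G) := by
  have hI := span_gens_edgeIdeal_pow (k := k) (G := G) 1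
  rw [pow_one] at hI
  rw [isScarf_iff hI]
  intro m
  by_cases H : ∃ x₁ x₂, G.Adj x₁ x₂ ∧ m x₁ ≠ 0 ∧ m x₂ ≠ 0
  · obtain ⟨x₁, x₂, h12, hm1, hm2⟩ := H
    obtain ⟨x, y, hxy, hmx, hmy, hrx, hmeet⟩ :=
      exists_edge_meeting_all hG hgap (fun v => m v ≠ 0) h12 hm1 hm2
    have hwg : edgeMonomial x y ∈ gens (edgeIdeal k G) := mem_gens_edgeIdeal.2 ⟨x, y, hxy, rfl⟩
    have hwm : edgeMonomial x y ≤ m := (edgeMonomial_le_iff hxy.ne).2 ⟨hmx, hmy⟩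
    refine isAcyclicComplex_of_cone (edgeMonomial x y) fun σ hσ => Or.inr ?_
    rcases hσ with rfl | ⟨hσ, hσm⟩
    · exact ⟨singleton_mem_scarfComplex hwg, by simpa [label] using hwm⟩
    · refine ⟨?_, by rw [label_insert]; exact sup_le hwm hσm⟩
      obtain ⟨-, hgens, hclosed, -⟩ := mem_scarfComplex_iff.1 hσ
      have hmeet' : ∀ z₁ z₂, G.Adj z₁ z₂ → edgeMonomial z₁ z₂ ∈ σ → G.Reachable x z₁ →
          z₁ = x ∨ z₁ = y ∨ z₂ = x ∨ z₂ = y := by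
        intro z₁ z₂ hz hzσ hr
        have := (edgeMonomial_le_iff hz.ne).1 ((le_label hzσ).trans hσm)
        exact hmeet z₁ z₂ hz this.1 this.2 (hrx.trans hr)
      -- If both ends of `xy` occur in the label of `σ`, then `xy` divides it and already belongs to
      -- `σ`; otherwise the lemma applies at an end that does not occur.
      by_cases hy : label σ y = 0
      · exact insert_mem_scarfComplex hG hxy hσ hmeet' hy
      by_cases hx : label σ x = 0
      · rw [edgeMonomial_comm]
        refine insert_mem_scarfComplex hG hxy.symm hσ (fun z₁ z₂ hz hzσ hr => ?_) hx
        have := hmeet' z₁ z₂ hz hzσ (hxy.reachable.trans hr)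
        tauto
      · rw [Finset.insert_eq_of_mem]
        · exact hσ
        · exact hclosed _ hwg ((edgeMonomial_le_iff hxy.ne).2 ⟨hx, hy⟩)
  · refine isAcyclicComplex_of_subset_singleton_empty ?_
    rintro σ (rfl | ⟨hσ, hσm⟩)
    · rfl
    · exfalso
      obtain ⟨⟨g, hg⟩, hgens, -, -⟩ := mem_scarfComplex_iff.1 hσ
      obtain ⟨u, v, huv, rfl⟩ := mem_gens_edgeIdeal.1 (hgens g hg)
      exact H ⟨u, v, huv, (edgeMonomial_le_iff huv.ne).1 ((le_label hg).trans hσm)⟩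

theorem isScarf_edgeIdeal_iff :
    IsScarf (edgeIdeal k G) ↔ G.IsAcyclic ∧ GapFree G := by
  refine ⟨fun hS => ?_, fun h => isScarf_edgeIdeal_of_isAcyclic_of_gapFree h.1 h.2⟩
  have h3 : ∀ a b c, G.Adj a b → G.Adj b c → ¬ G.Adj a c := fun a b c h1 h2 h3 =>
    not_isScarf_edgeIdeal_of_triangle h1 h2 h3 hS
  have hgap : GapFree G := gapFree_of_forall_not_induced_path h3
    fun a b c d e h1 h2 h3 h4 h5 h6 h7 h8 h9 h10 h11 h12 h13 h14 h15 => by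
      by_contra h16
      exact not_isScarf_edgeIdeal_of_induced_path h1 h2 h3 h4 h5 h6 h7 h8 h9 h10 h11 h12 h13 h14
        h15 h16 hS
  exact ⟨isAcyclic_of_gapFree hgap h3
    (fun a b c d h1 h2 h3 h4 h5 h6 => not_isScarf_edgeIdeal_of_four_cycle h1 h2 h3 h6 h4 h5 hS)
    (fun a b c d e h1 h2 h3 h4 h5 h6 h7 h8 h9 h10 =>
      not_isScarf_edgeIdeal_of_five_cycle h1 h2 h3 h4 h10 h5 h6 h7 h8 h9 hS), hgap⟩

/-! ### Powers of the edge ideal of a short path -/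

variable {I : Ideal (MvPolynomial V k)}

/-- A monomial ideal with at most one minimal generator has a Scarf resolution. -/
theorem isScarf_of_subsingleton_gens
    (hI : Ideal.span ((fun a => MvPolynomial.monomial a (1 : k)) '' gens I) = I)
    (h : (gens I).Subsingleton) : IsScarf I := by
  rw [isScarf_iff hI]
  intro m
  have hface : ∀ σ ∈ facesBelow (scarfComplex I) m, ∀ g ∈ σ, σ = {g} ∧ g ∈ gens I ∧ g ≤ m := by
    rintro σ (rfl | ⟨hσ, hm⟩) g hg
    · simp at hg
    · have hgens := (mem_scarfComplex_iff.1 hσ).2.1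
      exact ⟨Finset.eq_singleton_iff_unique_mem.2 ⟨hg, fun x hx => h (hgens x hx) (hgens g hg)⟩,
        hgens g hg, (le_label hg).trans hm⟩
  by_cases H : ∃ g ∈ gens I, g ≤ m
  · obtain ⟨g, hg, hgm⟩ := H
    refine isAcyclicComplex_of_cone g fun σ hσ => ?_
    have : insert g σ = {g} := by
      rw [Finset.eq_singleton_iff_unique_mem]
      refine ⟨Finset.mem_insert_self _ _, fun x hx => ?_⟩
      rcases Finset.mem_insert.1 hx with hx | hx
      · exact hx
      · exact h (hface σ hσ x hx).2.1 hg
    rw [this]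
    exact Or.inr ⟨singleton_mem_scarfComplex hg, by rwa [label_singleton]⟩
  · refine isAcyclicComplex_of_subset_singleton_empty fun σ hσ => ?_
    rw [Finset.eq_empty_iff_forall_notMem]
    exact fun g hg => H ⟨g, (hface σ hσ g hg).2⟩

/-- A monomial ideal whose generators `p 0, …, p t` are such that each one divides the least common
multiple of any two surrounding it, and of no other pair, has a Scarf resolution, supported on a
path. -/
theorem isScarf_of_gens_eq_image
    (hI : Ideal.span ((fun a => MvPolynomial.monomial a (1 : k)) '' gens I) = I) {t : ℕ}
    (p : ℕ → V →₀ ℕ) (hp : ∀ g, g ∈ gens I ↔ ∃ i ≤ t, g = p i)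
    (hinj : ∀ i ≤ t, ∀ j ≤ t, p i = p j → i = j)
    (hle : ∀ i j l, i ≤ j → j ≤ t → l ≤ t → (p l ≤ p i ⊔ p j ↔ i ≤ l ∧ l ≤ j)) : IsScarf I := by
  rw [isScarf_iff hI]
  intro m
  -- The subcomplex on the generators of index at most `N`; the path is built up one vertex at a
  -- time.
  let K (N : ℕ) : Set (Finset (V →₀ ℕ)) :=
    {σ ∈ facesBelow (scarfComplex I) m | ∀ i ≤ t, p i ∈ σ → i ≤ N}
  have hgens {σ} (hσ : σ ∈ facesBelow (scarfComplex I) m) {g} (hg : g ∈ σ) :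
      ∃ i ≤ t, g = p i ∧ p i ≤ m := by
    rcases hσ with rfl | ⟨hσ, hm⟩
    · simp at hg
    · obtain ⟨i, hi, rfl⟩ := (hp g).1 ((mem_scarfComplex_iff.1 hσ).2.1 g hg)
      exact ⟨i, hi, rfl, (le_label hg).trans hm⟩
  have hconv {σ} (hσ : σ ∈ facesBelow (scarfComplex I) m) {i j l : ℕ} (hil : i ≤ l) (hlj : l ≤ j)
      (hj : j ≤ t) (hi : p i ∈ σ) (hjσ : p j ∈ σ) : p l ∈ σ := by
    rcases hσ with rfl | ⟨hσ, hm⟩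
    · simp at hi
    · refine (mem_scarfComplex_iff.1 hσ).2.2.1 _ ((hp _).2 ⟨l, hlj.trans hj, rfl⟩) ?_
      exact ((hle i j l (hil.trans hlj) hj (hlj.trans hj)).2 ⟨hil, hlj⟩).trans
        (sup_le (le_label hi) (le_label hjσ))
  have hadj {σ} (hσ : σ ∈ facesBelow (scarfComplex I) m) {i j : ℕ} (hj : j ≤ t)
      (hi : p i ∈ σ) (hjσ : p j ∈ σ) : j ≤ i + 1 := by
    by_contra! hij
    have hl := hconv hσ (Nat.le_succ i) hij.le hj hi hjσ
    rcases hσ with rfl | ⟨hσ, hm⟩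
    · simp at hi
    · have hne : p (i + 1) ≠ p i := fun h => by
        have := hinj _ (by omega) _ (by omega) h
        omega
      have hne' : p (i + 1) ≠ p j := fun h => by
        have := hinj _ (by omega) _ (by omega) h
        omega
      refine (mem_scarfComplex_iff.1 hσ).2.2.2 _ hl ⟨p i, Finset.mem_erase.2 ⟨hne.symm, hi⟩⟩ ?_
      exact ((hle i j (i + 1) (by omega) hj (by omega)).2 ⟨by omega, by omega⟩).trans
        (sup_le (le_label (Finset.mem_erase.2 ⟨hne.symm, hi⟩))
          (le_label (Finset.mem_erase.2 ⟨hne'.symm, hjσ⟩)))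
  have hsingle {i : ℕ} (hi : i ≤ t) (him : p i ≤ m) {N : ℕ} (hN : i ≤ N) : {p i} ∈ K N := by
    refine ⟨Or.inr ⟨singleton_mem_scarfComplex ((hp _).2 ⟨i, hi, rfl⟩), by rwa [label_singleton]⟩,
      fun j hj hji => ?_⟩
    exact (hinj j hj i hi (Finset.mem_singleton.1 hji)).trans_le hN
  have hpoint (N : ℕ) (h : ∀ i, i < N → i ≤ t → ¬ p i ≤ m) : IsAcyclicComplex k (K N) := by
    have hface : ∀ σ ∈ K N, ∀ g ∈ σ, N ≤ t ∧ p N ≤ m ∧ g = p N := by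
      intro σ hσ g hg
      obtain ⟨i, hi, rfl, him⟩ := hgens hσ.1 hg
      have hiN := hσ.2 i hi hg
      have : i = N := by
        by_contra hne
        exact h i (by omega) hi him
      subst this
      exact ⟨hi, him, rfl⟩
    by_cases hN : N ≤ t ∧ p N ≤ m
    · refine isAcyclicComplex_of_cone (p N) fun σ hσ => ?_
      have : insert (p N) σ = {p N} := by
        rw [Finset.eq_singleton_iff_unique_mem]
        refine ⟨Finset.mem_insert_self _ _, fun x hx => ?_⟩
        rcases Finset.mem_insert.1 hx with hx | hx
        · exact hx
        · exact (hface σ hσ x hx).2.2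
      rw [this]
      exact hsingle hN.1 hN.2 le_rfl
    · refine isAcyclicComplex_of_subset_singleton_empty fun σ hσ => ?_
      rw [Finset.eq_empty_iff_forall_notMem]
      intro g hg
      have := hface σ hσ g hg
      exact hN ⟨this.1, this.2.1⟩
  have key : ∀ N, IsAcyclicComplex k (K N) := by
    intro N
    induction N with
    | zero => exact hpoint 0 (by simp)
    | succ N ih =>
      by_cases hv : N + 1 ≤ t ∧ p (N + 1) ≤ m
      · obtain ⟨hNt, hvm⟩ := hv
        by_cases hw : p N ≤ m
        · have hne : p (N + 1) ≠ p N := fun h => by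
            have := hinj _ hNt _ (by omega) h
            omega
          -- The last vertex `p (N + 1)` has `p N` as its only possible neighbour, so it can be
          -- deleted.
          refine isAcyclicComplex_of_dominated (v := p (N + 1)) (w := p N) ?_ hne ?_ ?_
          · rintro σ ⟨hσ, hσN⟩ g hg
            exact ⟨erase_mem_facesBelow σ hσ g hg,
              fun i hi h => hσN i hi (Finset.mem_of_mem_erase h)⟩
          · rintro σ ⟨hσ, hσN⟩ hvσ
            have heq : insert (p N) σ = {p N, p (N + 1)} := by
              ext g
              simp only [Finset.mem_insert, Finset.mem_singleton]
              refine or_congr_right' fun hgN => ⟨fun hg => ?_, fun hg => hg ▸ hvσ⟩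
              obtain ⟨i, hi, rfl, -⟩ := hgens hσ hg
              have h1 := hσN i hi hg
              have h2 := hadj hσ hNt hg hvσ
              have h3 : i ≠ N := fun h => hgN (h ▸ rfl)
              rw [show i = N + 1 by omega]
            rw [heq]
            refine ⟨Or.inr ⟨?_, ?_⟩, ?_⟩
            · rw [pair_mem_scarfComplex_iff ((hp _).2 ⟨N, by omega, rfl⟩)
                ((hp _).2 ⟨N + 1, hNt, rfl⟩) hne.symm]
              intro f hf hfl
              obtain ⟨l, hl, rfl⟩ := (hp f).1 hf
              rw [hle N (N + 1) l (by omega) hNt hl] at hfl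
              rcases (show l = N ∨ l = N + 1 by omega) with rfl | rfl
              · exact Or.inl rfl
              · exact Or.inr rfl
            · rw [label_pair]
              exact sup_le hw hvm
            · intro i hi h
              rcases Finset.mem_insert.1 h with h | h
              · have := hinj i hi N (by omega) h
                omega
              · have := hinj i hi (N + 1) hNt (Finset.mem_singleton.1 h)
                omega
          · have : {σ ∈ K (N + 1) | p (N + 1) ∉ σ} = K N := by
              ext σ
              constructor
              · rintro ⟨⟨hσ, hσN⟩, hvσ⟩
                refine ⟨hσ, fun i hi h => ?_⟩
                have h1 := hσN i hi h
                have h2 : i ≠ N + 1 := fun h' => hvσ (h' ▸ h)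
                omega
              · rintro ⟨hσ, hσN⟩
                refine ⟨⟨hσ, fun i hi h => (hσN i hi h).trans (Nat.le_succ N)⟩, fun h => ?_⟩
                have := hσN _ hNt h
                omega
            rw [this]
            exact ih
        -- The indices of the generators dividing `m` form an interval: if `p N` does not divide `m`
        -- but `p (N + 1)` does, no earlier one divides `m`.
        · refine hpoint _ fun i hiN hit him => hw ?_
          exact ((hle i (N + 1) N hiN.le hNt (by omega)).2 ⟨by omega, by omega⟩).trans
            (sup_le him hvm)
      · have : K (N + 1) = K N := by
          ext σ
          refine and_congr_right fun hσ => ⟨fun h i hi hiσ => ?_,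
            fun h i hi hiσ => (h i hi hiσ).trans (Nat.le_succ N)⟩
          have h1 := h i hi hiσ
          have h2 : i ≠ N + 1 := by
            rintro rfl
            obtain ⟨j, hj, hij, hjm⟩ := hgens hσ hiσ
            exact hv ⟨hi, hij ▸ hjm⟩
          omega
        rw [this]
        exact ih
  have : K t = facesBelow (scarfComplex I) m := by
    ext σ
    exact and_iff_left fun i hi _ => hi
  rw [← this]
  exact key t

theorem eq_monomialOn_of_surjective {n : ℕ} {f : Fin n ↪ V} (hf : Function.Surjective f)
    (s : V →₀ ℕ) : s = monomialOn f fun i => s (f i) := by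
  ext v
  obtain ⟨i, rfl⟩ := hf v
  rw [monomialOn_apply]

theorem isScarf_edgeIdeal_pow_of_iso_pathGraph_three (φ : G ≃g SimpleGraph.pathGraph 3) (t : ℕ) :
    IsScarf (edgeIdeal k G ^ t) := by
  let f : Fin 3 ↪ V := φ.symm.toEquiv.toEmbedding
  have hf : Function.Surjective f := φ.symm.surjective
  have hadj (i j : Fin 3) : G.Adj (f i) (f j) ↔ (i : ℕ) + 1 = j ∨ (j : ℕ) + 1 = i := by
    rw [← SimpleGraph.pathGraph_adj]
    exact φ.symm.map_rel_iff
  have hmem (i j : ℕ) : monomialOn f ![i, i + j, j] ∈ edgeSums G (i + j) := by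
    induction i with
    | zero =>
      rw [zero_add]
      convert monomialOn_nsmul_mem_edgeSums (f := f) (i := 1) (j := 2)
        ((hadj 1 2).2 (by decide)) j using 2
      ext l; fin_cases l <;> simp
    | succ i ih =>
      rw [show i + 1 + j = i + j + 1 by ring]
      convert monomialOn_add_mem_edgeSums (f := f) (i := 0) (j := 1)
        ((hadj 0 1).2 (by decide)) ih using 2
      ext l; fin_cases l <;> simp +arith
  refine isScarf_of_gens_eq_image (span_gens_edgeIdeal_pow t) (t := t)
    (fun i => monomialOn f ![i, t, t - i]) ?_ ?_ ?_
  · intro g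
    rw [gens_edgeIdeal_pow]
    constructor
    · intro hg
      obtain ⟨x, rfl⟩ : ∃ x, g = monomialOn f x := ⟨_, eq_monomialOn_of_surjective hf g⟩
      have hsum := sum_eq_of_mem_edgeSums hg
      -- Every edge contains the middle vertex, so its exponent is `t` and the two end exponents sum
      -- to `t`.
      have hw := sum_mul_eq_of_mem_edgeSums (c := ![0, 1, 0]) (d := 1) (by
        intro i j
        rw [hadj]
        revert i j
        decide) hg
      simp [Fin.sum_univ_succ] at hsum hw
      refine ⟨x 0, by omega, congrArg _ ?_⟩
      simp [funext_iff, Fin.forall_fin_succ]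
      omega
    · rintro ⟨i, hi, rfl⟩
      have := hmem i (t - i)
      rwa [Nat.add_sub_cancel' hi] at this
  · intro i _ j _ h
    exact congrFun (monomialOn_injective h) 0
  · intro i j l hij hj hl
    rw [← monomialOn_sup, monomialOn_le_iff]
    simp [Pi.le_def, Fin.forall_fin_succ]
    omega

theorem isScarf_edgeIdeal_pow_iff (hG : G.Connected) {t : ℕ} (ht : 1 < t) :
    IsScarf (edgeIdeal k G ^ t) ↔ Nonempty (G ≃g SimpleGraph.pathGraph 1) ∨
      Nonempty (G ≃g SimpleGraph.pathGraph 2) ∨ Nonempty (G ≃g SimpleGraph.pathGraph 3) := by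
  obtain ⟨t, rfl⟩ := Nat.exists_eq_add_of_le' ht
  constructor
  · intro hS
    refine nonempty_iso_pathGraph_of_connected hG
      (fun a b c h1 h2 h3 => not_isScarf_of_triangle h1 h2 h3 (t + 1) hS)
      (fun u a b c h1 h2 h3 h4 h5 => ?_) (fun a b c d h1 h2 h3 h4 h5 => ?_)
    · by_contra h6
      exact not_isScarf_of_claw h1 h2 h3 h4 h5 h6 t hS
    · by_contra h6
      exact not_isScarf_of_path h1 h2 h3 h4 h5 h6 t hS
  · rintro (⟨⟨φ⟩⟩ | ⟨⟨φ⟩⟩ | ⟨⟨φ⟩⟩)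
    · refine isScarf_of_subsingleton_gens (span_gens_edgeIdeal_pow _) ?_
      rw [gens_edgeIdeal_pow]
      rintro _ ⟨u, v, huv, -⟩
      exact absurd (φ.injective (Subsingleton.elim _ _)) huv.ne
    · refine isScarf_of_subsingleton_gens (span_gens_edgeIdeal_pow _) ?_
      rw [gens_edgeIdeal_pow]
      let f : Fin 2 ↪ V := φ.symm.toEquiv.toEmbedding
      have hf : Function.Surjective f := φ.symm.surjective
      have hadj (i j : Fin 2) : G.Adj (f i) (f j) ↔ (i : ℕ) + 1 = j ∨ (j : ℕ) + 1 = i := by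
        rw [← SimpleGraph.pathGraph_adj]
        exact φ.symm.map_rel_iff
      have key : ∀ s ∈ edgeSums G (t + 2), s = monomialOn f fun _ => t + 2 := by
        intro s hs
        obtain ⟨x, rfl⟩ : ∃ x, s = monomialOn f x := ⟨_, eq_monomialOn_of_surjective hf s⟩
        have hsum := sum_eq_of_mem_edgeSums hs
        have hw := sum_mul_eq_of_mem_edgeSums (c := ![0, 1]) (d := 1) (by
          intro i j
          rw [hadj]
          revert i j
          decide) hs
        simp [Fin.sum_univ_succ] at hsum hw
        congr 1
        simp [funext_iff, Fin.forall_fin_succ]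
        omega
      intro s hs r hr
      rw [key s hs, key r hr]
    · exact isScarf_edgeIdeal_pow_of_iso_pathGraph_three φ _

end ScarfIdeal
end


theorem theoremt {V : Type*} [Finite V] (k : Type*) [Field k] (G : SimpleGraph V) :
    ((ScarfIdeal.SupportsMinimalFreeResolution
          (ScarfIdeal.scarfComplex (ScarfIdeal.edgeIdeal k G)) (ScarfIdeal.edgeIdeal k G) ↔
        G.IsAcyclic ∧ ScarfIdeal.GapFree G) ∧
      (ScarfIdeal.IsScarf (ScarfIdeal.edgeIdeal k G) ↔ G.IsAcyclic ∧ ScarfIdeal.GapFree G)) ∧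
    (G.Connected → ∀ t : ℕ, 1 < t →
      (ScarfIdeal.SupportsMinimalFreeResolution
            (ScarfIdeal.scarfComplex (ScarfIdeal.edgeIdeal k G ^ t))
            (ScarfIdeal.edgeIdeal k G ^ t) ↔
          Nonempty (G ≃g SimpleGraph.pathGraph 1) ∨ Nonempty (G ≃g SimpleGraph.pathGraph 2) ∨
            Nonempty (G ≃g SimpleGraph.pathGraph 3)) ∧
        (ScarfIdeal.IsScarf (ScarfIdeal.edgeIdeal k G ^ t) ↔
          Nonempty (G ≃g SimpleGraph.pathGraph 1) ∨ Nonempty (G ≃g SimpleGraph.pathGraph 2) ∨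
            Nonempty (G ≃g SimpleGraph.pathGraph 3))) := by
  -- Scarf resolutions are automatically minimal, so the two versions of each equivalence coincide.
  simp only [ScarfIdeal.supportsMinimalFreeResolution_scarfComplex_iff, and_self]
  exact ⟨ScarfIdeal.isScarf_edgeIdeal_iff,
    fun hG t ht => ScarfIdeal.isScarf_edgeIdeal_pow_iff hG ht⟩
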